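/- **Setting.** For $L>0$ let $\mathcal T_L=[0,L]^3$ be the three-dimensional torus and let $H_L$ be the space of periodic, divergence-free, zero-mean fields $u\in L^2(\mathcal T_L;\mathbb R^3)$ with $|u|^2_{H_L}=L^{-3}\int_{\mathcal T_L}|u|^2dx$. Put $\Lambda_L^{(\infty)}=\frac{2\pi}{L}\mathbb Z^3\setminus\{0\}$, $\Lambda^{(n)}_L=\{k\in\Lambda_L^{(\infty)}:|k|\le 2\pi n/L\}$ and $\hat u(k)=L^{-3}\int_{\mathcal T_L}e^{ik\cdot x}u(x)\,dx$. Let $A_L=-\Delta$ be the Stokes operator on $H_L$, with domain $D(A_L)$ the fields of $H_L$ in $\mathbb H^2$. Let $\mathcal P_L$ be the set of Borel probability measures $\mu$ on $H_L$ such that $\mu(D(A_L))=1$, $\int\int_{\mathcal T_L}\|Du(x)\|^2dx\,d\mu(u)<\infty$, $u(\cdot-a)$ has the same law as $u$ under $\mu$ for every $a\in\mathcal T_L$, and $u(R\,\cdot)$ has the same law as $Ru(\cdot)$ under $\mu$ for every rotation $R$ preserving the set of coordinate axes. **Noise.** Fix complex $3\times3$ matrices $\sigma_k$, $k\in\Lambda_1^{(\infty)}$,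 with $k\cdot\sigma_k=0$, $\overline{\sigma_k}=\sigma_{-k}$, $|\sigma_{Rk}|=|\sigma_k|$ for every $R$ as above (with $|\cdot|$ the Hilbert–Schmidt norm), $\sum_k|\sigma_k|^2<\infty$ and $\sum_k|k|^2|\sigma_k|^2<\infty$. Let $(\beta_k)$ be complex three-dimensional Brownian motions with independent components, independent real and imaginary parts, and $E|\beta_k^j(t)|^2=t$, such that $\beta_{-k}=\overline{\beta_k}$ and the $\beta_k$ are otherwise independent. For $k\in\Lambda_L^{(\infty)}$ put $\sigma_k^L=\sigma_{Lk}$ and $\beta^L_k=\beta_{Lk}$. **Stationary Navier–Stokes measures.** For $\nu>0$ and $n\in\mathbb N$ let $H^{(n)}_L$ be the subspace of $H_L$ of fields with modes in $\Lambda^{(n)}_L$, let $\pi^{(n)}_L$ be the orthogonal projection of $H_L$ onto it, and consider the Galerkin equation in $H_L^{(n)}$ $$du+\big[\nu A_Lu+\pi_L^{(n)}\big((u\cdot\nabla)u\big)\big]dt=\sum_{k\in\Lambda_L^{(n)}}\sigma_k^L\,d\beta_k^L\,e^{-ik\cdot x}.$$ Let $\mathcal S^n(\nu,L)$ be the set of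 its invariant measures that belong to $\mathcal P_L$, and let $\mathcal P^G_{NS}(\nu,L)$ be the set of probability measures $\mu$ on $H_L$ for which there are $k_j\to\infty$ and $\mu_j\in\mathcal S^{k_j}(\nu,L)$ with $\mu_j\to\mu$ weakly on $H_L$. Let $\tilde{\mathcal P}^G_{NS}$ be the set of all triples $(\mu,\nu,L)$ with $\nu,L>0$ and $\mu\in\mathcal P^G_{NS}(\nu,L)$. **Conditions.** An *admissible region* is a set $D=\{(\nu,L):0<\nu<\nu_0,\ L>R_0(\nu)\}$, where $\nu_0>0$ and $R_0:(0,\nu_0]\to[1,\infty)$ is strictly decreasing with $R_0(\nu)\to\infty$ as $\nu\to0$. Let $e$ be a coordinate unit vector. A set $\mathcal M$ of triples $(\mu,\nu,L)$, with $\mu$ a probability measure on $H_L$, satisfies *Condition A* if there are an admissible region $D$ and constants $C>c>0$ such that $$c\le\int_{H_L}\|u(e)-u(0)\|^2\,d\mu(u)\le C\qquad\text{for all }(\mu,\nu,L)\in\mathcal M\text{ with }(\nu,L)\in D;$$ here $u(x)$ is the limit of the averages of $u$ over the cubes $\{y:\max_j|y_j-x_j|<1/(n+1)\}$ as $n\to\infty$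 ($0$ if there is no limit), which is the value at $x$ of the continuous representative of $u$ if there is one. It satisfies *Condition B* if there are an admissible region $D$ and constants $C>c>0$ such that $$c\le\sum_{k\in\Lambda_L^{(\infty)},\,\|k\|\le1}\|k\|^2\int_{H_L}\|\hat u(k)\|^2d\mu(u)+\sum_{k\in\Lambda_L^{(\infty)},\,\|k\|>1}\int_{H_L}\|\hat u(k)\|^2d\mu(u)\le C$$ for all $(\mu,\nu,L)\in\mathcal M$ with $(\nu,L)\in D$. **Theorem (Condition A implies Condition B).** If $\tilde{\mathcal P}^G_{NS}$ satisfies Condition A (for one coordinate unit vector $e$), then it satisfies Condition B (the admissible regions and constants in the two conditions need not be the same). -/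

import Mathlib

open MeasureTheory ProbabilityTheory Filter Topology BoundedContinuousFunction
open scoped NNReal ENNReal

namespace NSK41

noncomputable section

/-! ### The torus `𝒯_L = [0,L]³` and vector fields on it -/

/-- The three-dimensional torus of side `L`. -/
abbrev Torus (L : ℝ) : Type := Fin 3 → AddCircle L

/-- Velocities, with the Euclidean norm. -/
abbrev Vec : Type := EuclideanSpace ℝ (Fin 3)

/-- The normalised Lebesgue measure `L⁻³ dx` on the torus. -/
def torusMeasure (L : ℝ) [Fact (0 < L)] : Measure (Torus L) :=
  Measure.pi fun _ => AddCircle.haarAddCircle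

instance (L : ℝ) [Fact (0 < L)] : IsProbabilityMeasure (torusMeasure L) := by
  unfold torusMeasure; infer_instance

instance (L : ℝ) [Fact (0 < L)] : (torusMeasure L).IsAddHaarMeasure := by
  unfold torusMeasure; infer_instance

/-- `𝕃²(𝒯_L)`, with the inner product `L⁻³ ∫ u · v dx`. -/
abbrev L2 (L : ℝ) [Fact (0 < L)] : Type := Lp Vec 2 (torusMeasure L)

/-- The partial derivative `∂f/∂x_j` of a function on the torus. -/
def pderiv {L : ℝ} (j : Fin 3) (f : Torus L → ℝ) (x : Torus L) : ℝ :=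
  deriv (fun t : ℝ => f (x + Pi.single j (t : AddCircle L))) 0

/-- `C^∞` functions on the torus: those whose periodic lift to `ℝ³` is `C^∞`. -/
def IsSmooth {L : ℝ} (f : Torus L → ℝ) : Prop :=
  ContDiff ℝ ((⊤ : ℕ∞) : WithTop ℕ∞) fun y : Fin 3 → ℝ => f fun j => (y j : AddCircle L)

/-- `div u = 0` on the torus, in the sense of distributions. -/
def IsDivFree {L : ℝ} [Fact (0 < L)] (u : L2 L) : Prop :=
  ∀ φ : Torus L → ℝ, IsSmooth φ → ∫ x, ∑ j, u x j * pderiv j φ x ∂torusMeasure L = 0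

/-- The space `H_L` of periodic, divergence-free, zero-mean fields in `𝕃²(𝒯_L)`. -/
abbrev H (L : ℝ) [Fact (0 < L)] : Type :=
  {u : L2 L // IsDivFree u ∧ ∫ x, u x ∂torusMeasure L = 0}

instance (L : ℝ) [Fact (0 < L)] : MeasurableSpace (H L) := borel (H L)

instance (L : ℝ) [Fact (0 < L)] : BorelSpace (H L) := ⟨rfl⟩

/-! ### Fourier analysis.  The wave vector `k = (2π/L) m` is indexed by `m ∈ ℤ³`. -/

/-- The wave vector `k = (2π/L) m`. -/
def wave (L : ℝ) (m : Fin 3 → ℤ) : Vec := WithLp.toLp 2 fun j => 2 * Real.pi / L * (m j : ℝ)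

/-- The character `x ↦ e^{i k·x}` with `k = (2π/L) m`. -/
def character {L : ℝ} (m : Fin 3 → ℤ) (x : Torus L) : ℂ := ∏ j, fourier (m j) (x j)

/-- `û(k) = L⁻³ ∫ e^{i k·x} u(x) dx`, so that `u(x) = ∑ₖ e^{-i k·x} û(k)`. -/
def fourierCoef {L : ℝ} [Fact (0 < L)] (u : L2 L) (m : Fin 3 → ℤ) : EuclideanSpace ℂ (Fin 3) :=
  WithLp.toLp 2 fun j => ∫ x, character m x * (u x j : ℂ) ∂torusMeasure L

/-- `L⁻³ ∫ ‖Du‖² dx = ∑ₖ |k|² ‖û(k)‖²`, finite if and only if `u` is in `ℍ¹`. -/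
def dirichletEnergy {L : ℝ} [Fact (0 < L)] (u : L2 L) : ℝ≥0∞ :=
  ∑' m : Fin 3 → ℤ, ‖wave L m‖ₑ ^ 2 * ‖fourierCoef u m‖ₑ ^ 2

/-- The domain `D(A_L) = H_L ∩ ℍ²` of the Stokes operator. -/
def stokesDomain (L : ℝ) [Fact (0 < L)] : Set (H L) :=
  {u | ∑' m : Fin 3 → ℤ, ‖wave L m‖ₑ ^ 4 * ‖fourierCoef u.1 m‖ₑ ^ 2 < ∞}

/-! ### Translations and coordinate rotations; the class `𝒫_L` -/

theorem measurePreserving_sub (L : ℝ) [Fact (0 < L)] (a : Torus L) :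
    MeasurePreserving (fun x => x - a) (torusMeasure L) (torusMeasure L) :=
  measurePreserving_sub_right _ a

/-- `u ↦ u(· - a)`. -/
def translate {L : ℝ} [Fact (0 < L)] (a : Torus L) (u : L2 L) : L2 L :=
  Lp.compMeasurePreserving (fun x => x - a) (measurePreserving_sub L a) u

/-- Rotations mapping the set of coordinate axes to itself: integer rotation matrices. -/
abbrev CoordRotation : Type := Matrix.specialOrthogonalGroup (Fin 3) ℤ

/-- The action `x ↦ R x` of a coordinate rotation on the torus. -/
def torusRotation (L : ℝ) (R : CoordRotation) : Torus L →+ Torus L where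
  toFun x j := ∑ l, R.1 j l • x l
  map_zero' := by ext j; simp
  map_add' x y := by ext j; simp [Finset.sum_add_distrib]

theorem measurePreserving_torusRotation (L : ℝ) [Fact (0 < L)] (R : CoordRotation) :
    MeasurePreserving (torusRotation L R) (torusMeasure L) (torusMeasure L) := by
  refine AddMonoidHom.measurePreserving ?_ ?_ rfl
  · refine continuous_pi fun j => ?_
    exact continuous_finsetSum Finset.univ fun l _ => (continuous_apply l).zsmul (R.1 j l)
  · have h : ∀ (S T : CoordRotation) (x : Torus L),
        torusRotation L (S * T) x = torusRotation L S (torusRotation L T x) := by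
      intro S T x
      ext j
      simp only [torusRotation, AddMonoidHom.coe_mk, ZeroHom.coe_mk, Finset.smul_sum]
      rw [Finset.sum_comm]
      refine Finset.sum_congr rfl fun l _ => ?_
      simp [Matrix.mul_apply, Finset.sum_smul, mul_smul]
    have h1 : ∀ x : Torus L, torusRotation L 1 x = x := by
      intro x
      ext j
      simp [torusRotation, Matrix.one_apply, ite_smul]
    intro y
    exact ⟨torusRotation L R⁻¹ y, by rw [← h, mul_inv_cancel, h1]⟩

/-- `u ↦ u(R ·)`. -/
def rotateArgument {L : ℝ} [Fact (0 < L)] (R : CoordRotation) (u : L2 L) : L2 L :=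
  Lp.compMeasurePreserving (torusRotation L R) (measurePreserving_torusRotation L R) u

/-- `u ↦ R u(·)`. -/
def rotateValue {L : ℝ} [Fact (0 < L)] (R : CoordRotation) (u : L2 L) : L2 L :=
  (Matrix.toEuclideanCLM (n := Fin 3) (𝕜 := ℝ) (R.1.map (Int.cast : ℤ → ℝ))).compLp u

/-- The class `𝒫_L`: probability measures on `H_L`, concentrated on `D(A_L)`, with finite mean
of `∫ ‖Du‖²`, space homogeneous and partially (discretely) isotropic. -/
structure InClassP (L : ℝ) [Fact (0 < L)] (μ : ProbabilityMeasure (H L)) : Prop where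
  domain : ∀ᵐ u ∂(μ : Measure (H L)), u ∈ stokesDomain L
  finite_enstrophy : ∫⁻ u, dirichletEnergy u.1 ∂(μ : Measure (H L)) < ∞
  homogeneous : ∀ (a : Torus L) (f : L2 L →ᵇ ℝ),
    ∫ u, f (translate a u.1) ∂(μ : Measure (H L)) = ∫ u, f u.1 ∂(μ : Measure (H L))
  isotropic : ∀ (R : CoordRotation) (f : L2 L →ᵇ ℝ),
    ∫ u, f (rotateArgument R u.1) ∂(μ : Measure (H L)) =
      ∫ u, f (rotateValue R u.1) ∂(μ : Measure (H L))

/-! ### The noise -/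

/-- `|M|² = ∑ᵢⱼ |Mᵢⱼ|²`. -/
def matrixNormSq (M : Matrix (Fin 3) (Fin 3) ℂ) : ℝ := ∑ i, ∑ j, ‖M i j‖ ^ 2

/-- The covariance coefficients `σ_k` of the noise on the unit torus, `k = 2πm` with
`m ∈ ℤ³ ∖ {0}`.  On the torus of side `L` the coefficient of `k = (2π/L) m` is `σ_{Lk}`,
that is, again the one with index `m`.  The value at `m = 0` is never used. -/
structure NoiseCoefficients where
  σ : (Fin 3 → ℤ) → Matrix (Fin 3) (Fin 3) ℂ
  divFree : ∀ m, m ≠ 0 → Matrix.vecMul (fun j => (wave 1 m j : ℂ)) (σ m) = 0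
  summable : Summable fun m : {m : Fin 3 → ℤ // m ≠ 0} => matrixNormSq (σ m)
  real : ∀ m, m ≠ 0 → (σ m).map (starRingEnd ℂ) = σ (-m)
  isotropic : ∀ m, m ≠ 0 → ∀ R : CoordRotation,
    matrixNormSq (σ (R.1.mulVec m)) = matrixNormSq (σ m)
  summable_sq : Summable fun m : {m : Fin 3 → ℤ // m ≠ 0} => ‖wave 1 m‖ ^ 2 * matrixNormSq (σ m)

/-- One half of `ℤ³ ∖ {0}`, containing exactly one of `m`, `-m` for every `m ≠ 0`. -/
abbrev HalfLattice : Type := {m : Fin 3 → ℤ // (0 : Lex (Fin 3 → ℤ)) < toLex m}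

/-- The driving processes: `β_m` is a complex three-dimensional Brownian motion with
`E|β_m^j(t)|² = t`, `β_{-m}` is its complex conjugate (this makes the noise real and space
homogeneous), and they are otherwise independent: the processes `√2 Re β_m^j`, `√2 Im β_m^j`,
with `m` in the half lattice, are independent standard Brownian motions. -/
structure IsDrivingNoise {Ω : Type} [MeasurableSpace Ω] (P : Measure Ω)
    (β : (Fin 3 → ℤ) → Fin 3 → ℝ≥0 → Ω → ℂ) : Prop where
  measurable : ∀ m j t, Measurable (β m j t)
  conj : ∀ m j t ω, β (-m) j t ω = starRingEnd ℂ (β m j t ω)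
  brownian_re : ∀ (m : HalfLattice) (j : Fin 3),
    IsBrownianReal (fun t ω => √2 * (β m j t ω).re) P
  brownian_im : ∀ (m : HalfLattice) (j : Fin 3),
    IsBrownianReal (fun t ω => √2 * (β m j t ω).im) P
  indep : iIndepFun (fun (q : HalfLattice × Fin 3 × Bool) (ω : Ω) (t : ℝ≥0) =>
    if q.2.2 then (β q.1 q.2.1 t ω).re else (β q.1 q.2.1 t ω).im) P

/-! ### Galerkin approximations of the stochastic Navier–Stokes equations -/

/-- The modes `0 < |k| ≤ 2πn/L`, that is, `0 < |m| ≤ n`. -/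
def modes (n : ℕ) : Finset (Fin 3 → ℤ) :=
  (Fintype.piFinset fun _ => Finset.Icc (-(n : ℤ)) n).filter
    fun m => m ≠ 0 ∧ ∑ j, m j ^ 2 ≤ (n : ℤ) ^ 2

/-- The subspace `H_L^{(n)}` of fields whose only modes are those of index `n`. -/
def galerkinSpace (L : ℝ) [Fact (0 < L)] (n : ℕ) : Set (H L) :=
  {u | ∀ m, m ∉ modes n → fourierCoef u.1 m = 0}

/-- The trigonometric polynomial `∑ e^{-i k·x} û(k)` over the modes of index `n`; for `u` in
`H_L^{(n)}` this is the smooth representative of `u`. -/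
def trigPoly {L : ℝ} [Fact (0 < L)] (n : ℕ) (u : L2 L) (x : Torus L) : Vec :=
  WithLp.toLp 2 fun j => (∑ m ∈ modes n, character (-m) x * fourierCoef u m j).re

/-- `Δ u`. -/
def laplace {L : ℝ} (u : Torus L → Vec) (x : Torus L) : Vec :=
  WithLp.toLp 2 fun j => ∑ i, pderiv i (pderiv i fun y => u y j) x

/-- `(u · ∇) v`. -/
def advect {L : ℝ} (u v : Torus L → Vec) (x : Torus L) : Vec :=
  WithLp.toLp 2 fun j => ∑ i, u x i * pderiv i (fun y => v y j) x

/-- `∑ σ_k b_k e^{-i k·x}` over the modes of index `n`. -/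
def noiseField {L : ℝ} (σ : NoiseCoefficients) (n : ℕ) (b : (Fin 3 → ℤ) → Fin 3 → ℂ)
    (x : Torus L) : Vec :=
  WithLp.toLp 2 fun j => (∑ m ∈ modes n, character (-m) x * (σ.σ m).mulVec (b m) j).re

/-- `v` solves, along the noise path `b`, the Galerkin equation in `H_L^{(n)}`
`dv + [ν A v + π B(v,v)] dt = ∑ σ_k db_k e^{-i k·x}`,
written in integrated form and tested against the elements of `H_L^{(n)}`. -/
structure IsGalerkinPath (σ : NoiseCoefficients) (ν L : ℝ) [Fact (0 < L)] (n : ℕ)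
    (b : (Fin 3 → ℤ) → Fin 3 → ℝ≥0 → ℂ) (v : ℝ≥0 → H L) : Prop where
  continuous : Continuous v
  mem : ∀ t, v t ∈ galerkinSpace L n
  equation : ∀ w ∈ galerkinSpace L n, ∀ t : ℝ≥0,
    inner ℝ (v t).1 w.1 = inner ℝ (v 0).1 w.1
      + (∫ s in (0 : ℝ)..t, ∫ x, inner ℝ
          (ν • laplace (trigPoly n (v s.toNNReal).1) x
            - advect (trigPoly n (v s.toNNReal).1) (trigPoly n (v s.toNNReal).1) x)
          (w.1 x) ∂torusMeasure L)
      + ∫ x, inner ℝ (noiseField σ n (fun m j => b m j t) x) (w.1 x) ∂torusMeasure L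

/-- `μ` is an invariant measure of the Galerkin equation: the solution issued from an initial
datum with law `μ`, independent of the noise, has law `μ` at all times. -/
def IsGalerkinInvariant (σ : NoiseCoefficients) (ν L : ℝ) [Fact (0 < L)] (n : ℕ)
    (μ : ProbabilityMeasure (H L)) : Prop :=
  ∃ (Ω : Type) (_ : MeasurableSpace Ω) (P : Measure Ω) (_ : IsProbabilityMeasure P)
    (β : (Fin 3 → ℤ) → Fin 3 → ℝ≥0 → Ω → ℂ) (u : ℝ≥0 → Ω → H L),
    IsDrivingNoise P β ∧ (∀ t, Measurable (u t)) ∧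
    IndepFun (u 0) (fun ω (m : Fin 3 → ℤ) (j : Fin 3) (t : ℝ≥0) => β m j t ω) P ∧
    (∀ᵐ ω ∂P, IsGalerkinPath σ ν L n (fun m j t => β m j t ω) fun t => u t ω) ∧
    ∀ t, P.map (u t) = μ

/-- The set `𝒮ⁿ` of homogeneous, isotropic invariant measures of the Galerkin equation. -/
def galerkinStationary (σ : NoiseCoefficients) (ν L : ℝ) [Fact (0 < L)] (n : ℕ) :
    Set (ProbabilityMeasure (H L)) :=
  {μ | InClassP L μ ∧ IsGalerkinInvariant σ ν L n μ}

/-- The set `𝒫_NS^G(ν, L)` of limit points, in the weak topology, of `𝒮ⁿ` as `n → ∞`. -/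
def stationaryNS (σ : NoiseCoefficients) (ν L : ℝ) [Fact (0 < L)] :
    Set (ProbabilityMeasure (H L)) :=
  {μ | ∃ (k : ℕ → ℕ) (μs : ℕ → ProbabilityMeasure (H L)), Tendsto k atTop atTop ∧
    (∀ i, μs i ∈ galerkinStationary σ ν L (k i)) ∧ Tendsto μs atTop (𝓝 μ)}

/-- Triples `(μ, ν, L)` with `ν, L > 0` and `μ` a probability measure on `H_L`. -/
structure Triple where
  ν : ℝ
  ν_pos : 0 < ν
  L : ℝ
  [L_pos : Fact (0 < L)]
  μ : ProbabilityMeasure (H L)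

attribute [instance] Triple.L_pos

/-- The rescaled family: all triples `(μ, ν, L)` with `μ ∈ 𝒫_NS^G(ν, L)`. -/
def rescaledNS (σ : NoiseCoefficients) : Set Triple :=
  {τ | τ.μ ∈ stationaryNS σ τ.ν τ.L}

/-! ### Conditions A and B -/

open Classical in
/-- The value `u(x)`: the limit of the averages of `u` over balls shrinking to `x` (and `0` where
there is no limit).  If `u` has a continuous representative, this is its value at `x`. -/
def pointValue {L : ℝ} [Fact (0 < L)] (u : L2 L) (x : Torus L) : Vec :=
  if h : ∃ a, Tendsto (fun n : ℕ => ⨍ y in Metric.ball x (1 / ((n : ℝ) + 1)), u y ∂torusMeasure L)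
    atTop (𝓝 a) then h.choose else 0

/-- `μ[‖u(e) - u(0)‖²]`, where `e` is the `i`-th coordinate unit vector. -/
def meanSquareIncrement (i : Fin 3) (τ : Triple) : ℝ≥0∞ :=
  ∫⁻ u, ‖pointValue u.1 (Pi.single i ((1 : ℝ) : AddCircle τ.L)) - pointValue u.1 0‖ₑ ^ 2
    ∂(τ.μ : Measure (H τ.L))

/-- `μ[‖û(k)‖²]`, with `k = (2π/L) m`. -/
def modeEnergy (τ : Triple) (m : Fin 3 → ℤ) : ℝ≥0∞ :=
  ∫⁻ u, ‖fourierCoef u.1 m‖ₑ ^ 2 ∂(τ.μ : Measure (H τ.L))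

/-- Enstrophy of the low modes `|k| ≤ 1` plus energy of the high modes `|k| > 1`. -/
def lowHighSum (τ : Triple) : ℝ≥0∞ :=
  (∑' m : {m : Fin 3 → ℤ // m ≠ 0 ∧ ‖wave τ.L m‖ ≤ 1}, ‖wave τ.L m‖ₑ ^ 2 * modeEnergy τ m) +
    ∑' m : {m : Fin 3 → ℤ // m ≠ 0 ∧ 1 < ‖wave τ.L m‖}, modeEnergy τ m

/-- Admissible regions `{(ν, L) : 0 < ν < ν₀, L > R₀(ν)}`, where `R₀ : (0, ν₀] → [1, ∞)` is
strictly decreasing and tends to `∞` at `0`. -/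
def IsAdmissible (D : Set (ℝ × ℝ)) : Prop :=
  ∃ (ν₀ : ℝ) (R₀ : ℝ → ℝ), 0 < ν₀ ∧ (∀ ν ∈ Set.Ioc 0 ν₀, 1 ≤ R₀ ν) ∧
    StrictAntiOn R₀ (Set.Ioc 0 ν₀) ∧ Tendsto R₀ (𝓝[>] 0) atTop ∧
    D = {p | 0 < p.1 ∧ p.1 < ν₀ ∧ R₀ p.1 < p.2}

/-- Condition A, with the `i`-th coordinate unit vector as `e`. -/
def ConditionA (i : Fin 3) (M : Set Triple) : Prop :=
  ∃ D, IsAdmissible D ∧ ∃ c C : ℝ, 0 < c ∧ c < C ∧ ∀ τ ∈ M, (τ.ν, τ.L) ∈ D →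
    ENNReal.ofReal c ≤ meanSquareIncrement i τ ∧ meanSquareIncrement i τ ≤ ENNReal.ofReal C

/-- Condition B. -/
def ConditionB (M : Set Triple) : Prop :=
  ∃ D, IsAdmissible D ∧ ∃ c C : ℝ, 0 < c ∧ c < C ∧ ∀ τ ∈ M, (τ.ν, τ.L) ∈ D →
    ENNReal.ofReal c ≤ lowHighSum τ ∧ lowHighSum τ ≤ ENNReal.ofReal C

end

end NSK41

namespace NSK41

noncomputable section

/-! For a homogeneous law, averaging over translations and Parseval turn the mean square increment
over the distance s in direction j into ∑ₖ 4 sin²(s kⱼ/2) μ[‖û(k)‖²]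
(`lintegral_pointValue_increment`). Since 4 sin²(x/2) ≤ min(x², 4), the increment at s = 1 is at
most four times the sum in Condition B; this gives the lower bound.

The upper bound is harder, because the weight at s = 1 vanishes for kⱼ ∈ 2πℤ and a single distance
can miss high modes. Averaging over s ∈ [1/8, 1] removes these zeros
(`integral_four_mul_sin_sq_ge`), but Condition A only controls s = 1. The other distances come from
a scaling symmetry of the whole family: u ↦ l⁻¹ u(l² t, l³ x) carries solutions for (ν, L) to
solutions for (ν/l⁴, L/l³). The noise keeps its law by Brownian scaling, since the coefficients σ
are indexed by m ∈ ℤ³ and so are the same on every torus. Invariant measures, the class 𝒫_L and weak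
limits are carried along (`rescaleLaw_mem_stationaryNS`). An increment over distance 1 after
rescaling is l⁻¹ times one over distance l³ before it, so l ∈ [1/2, 1] covers s = l³ ∈ [1/8, 1]
(`spectralIncrement_rescale`), and the rescaled parameters stay admissible once ν < ν₀/16.

Discrete isotropy makes the three coordinate directions equivalent (`spectralIncrement_eq`), and
every mode with |k| > 1 has some kⱼ² ≥ 1/3; `lowHighSum_le` collects these bounds. -/

/-! ### Dilations of the torus -/

/-- The dilation `x ↦ (L' / L) x` from the torus of side `L` to the torus of side `L'`. -/
def dilation (L L' : ℝ) [hL : Fact (0 < L)] [hL' : Fact (0 < L')] : Torus L →+ Torus L' where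
  toFun x j := AddCircle.equivAddCircle L L' hL.out.ne' hL'.out.ne' (x j)
  map_zero' := by ext j; simp
  map_add' x y := by ext j; simp

section Dilation

variable {L L' : ℝ} [hL : Fact (0 < L)] [hL' : Fact (0 < L')]

theorem dilation_apply_coe (y : Fin 3 → ℝ) :
    dilation L L' (fun j => (y j : AddCircle L)) =
      fun j => ((L⁻¹ * L' * y j : ℝ) : AddCircle L') := by
  ext j
  simp only [dilation, AddMonoidHom.coe_mk, ZeroHom.coe_mk, AddCircle.equivAddCircle_apply_mk]
  rw [mul_comm]

omit hL in
theorem exists_coe_torus (x : Torus L) : ∃ y : Fin 3 → ℝ, (fun j => (y j : AddCircle L)) = x :=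
  ⟨fun j => (QuotientAddGroup.mk_surjective (x j)).choose,
    funext fun j => (QuotientAddGroup.mk_surjective (x j)).choose_spec⟩

theorem dilation_dilation (x : Torus L) : dilation L' L (dilation L L' x) = x := by
  obtain ⟨y, rfl⟩ := exists_coe_torus x
  rw [dilation_apply_coe, dilation_apply_coe]
  have h := hL.out.ne'
  have h' := hL'.out.ne'
  ext j
  congr 1
  field_simp

theorem dilation_single (j : Fin 3) (t : ℝ) :
    dilation L L' (Pi.single j (t : AddCircle L)) =
      Pi.single j ((L⁻¹ * L' * t : ℝ) : AddCircle L') := by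
  ext i
  rcases eq_or_ne i j with rfl | h
  · simp only [dilation, AddMonoidHom.coe_mk, ZeroHom.coe_mk, Pi.single_eq_same,
      AddCircle.equivAddCircle_apply_mk]
    rw [mul_comm]
  · simp [dilation, Pi.single_eq_of_ne h]

theorem continuous_dilation : Continuous (dilation L L') :=
  continuous_pi fun j => (AddCircle.homeomorphAddCircle L L' hL.out.ne' hL'.out.ne').continuous.comp
    (continuous_apply j)

theorem measurePreserving_dilation (L L' : ℝ) [Fact (0 < L)] [Fact (0 < L')] :
    MeasurePreserving (dilation L L') (torusMeasure L) (torusMeasure L') :=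
  AddMonoidHom.measurePreserving continuous_dilation
    (fun y => ⟨dilation L' L y, dilation_dilation y⟩) (by simp)

theorem measurableEmbedding_dilation : MeasurableEmbedding (dilation L L') :=
  (Homeomorph.mk ⟨dilation L L', dilation L' L, dilation_dilation, dilation_dilation⟩
    continuous_dilation continuous_dilation).measurableEmbedding

/-- Wave vectors scale inversely to lengths, so a dilation keeps the index m and only changes the k
it stands for. -/
theorem character_dilation (m : Fin 3 → ℤ) (x : Torus L) :
    character m (dilation L L' x) = character m x := by
  obtain ⟨y, rfl⟩ := exists_coe_torus x
  rw [dilation_apply_coe]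
  refine Finset.prod_congr rfl fun j _ => ?_
  have h := hL.out.ne'
  have h' := hL'.out.ne'
  rw [fourier_coe_apply, fourier_coe_apply]
  congr 1
  push_cast
  have h1 : (L : ℂ) ≠ 0 := by exact_mod_cast h
  have h2 : (L' : ℂ) ≠ 0 := by exact_mod_cast h'
  field_simp

theorem torusRotation_dilation (R : CoordRotation) (x : Torus L) :
    torusRotation L' R (dilation L L' x) = dilation L L' (torusRotation L R x) := by
  ext j
  simp [torusRotation, dilation, map_sum, map_zsmul]

/-- `u ↦ u((L / L') ·)`, from fields on the torus of side `L` to fields on that of side `L'`. -/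
def dilate (L L' : ℝ) [Fact (0 < L)] [Fact (0 < L')] : L2 L →ₗᵢ[ℝ] L2 L' :=
  Lp.compMeasurePreservingₗᵢ ℝ (dilation L' L) (measurePreserving_dilation L' L)

theorem coeFn_dilate (u : L2 L) :
    dilate L L' u =ᵐ[torusMeasure L'] fun x => u (dilation L' L x) :=
  Lp.coeFn_compMeasurePreserving u (measurePreserving_dilation L' L)

theorem compMeasurePreserving_congr {f g : Torus L → Torus L'}
    (hf : MeasurePreserving f (torusMeasure L) (torusMeasure L'))
    (hg : MeasurePreserving g (torusMeasure L) (torusMeasure L')) (h : ∀ x, f x = g x) (u : L2 L') :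
    Lp.compMeasurePreserving f hf u = Lp.compMeasurePreserving g hg u := by
  obtain rfl : f = g := funext h
  rfl

theorem dilate_eq (u : L2 L) :
    dilate L L' u = Lp.compMeasurePreserving (dilation L' L) (measurePreserving_dilation L' L) u :=
  rfl

theorem dilate_dilate (u : L2 L) : dilate L' L (dilate L L' u) = u := by
  rw [dilate_eq, dilate_eq, ← Lp.compMeasurePreserving_comp_apply]
  exact (compMeasurePreserving_congr _ (.id _) dilation_dilation u).trans
    (Lp.compMeasurePreserving_id_apply u)

/-- A dilation is a homeomorphism, hence no measurability of the integrand is required; the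
integrands below contain derivatives of arbitrary functions. -/
theorem integral_dilation {E : Type*} [NormedAddCommGroup E] [NormedSpace ℝ E] (g : Torus L' → E) :
    ∫ x, g (dilation L L' x) ∂torusMeasure L = ∫ y, g y ∂torusMeasure L' :=
  (measurePreserving_dilation L L').integral_comp measurableEmbedding_dilation g

theorem translate_dilate (a : Torus L') (u : L2 L) :
    translate a (dilate L L' u) = dilate L L' (translate (dilation L' L a) u) := by
  rw [dilate_eq, dilate_eq, translate, translate, ← Lp.compMeasurePreserving_comp_apply,
    ← Lp.compMeasurePreserving_comp_apply]
  exact compMeasurePreserving_congr _ _ (fun x => by simp) u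

theorem rotateArgument_dilate (R : CoordRotation) (u : L2 L) :
    rotateArgument R (dilate L L' u) = dilate L L' (rotateArgument R u) := by
  rw [dilate_eq, dilate_eq, rotateArgument, rotateArgument, ← Lp.compMeasurePreserving_comp_apply,
    ← Lp.compMeasurePreserving_comp_apply]
  exact compMeasurePreserving_congr _ _ (fun x => by simp [torusRotation_dilation]) u

theorem coeFn_rotateValue (R : CoordRotation) (u : L2 L) :
    rotateValue R u =ᵐ[torusMeasure L] fun x =>
      Matrix.toEuclideanCLM (n := Fin 3) (𝕜 := ℝ) (R.1.map (Int.cast : ℤ → ℝ)) (u x) :=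
  ContinuousLinearMap.coeFn_compLp (Matrix.toEuclideanCLM (n := Fin 3) (𝕜 := ℝ)
    (R.1.map (Int.cast : ℤ → ℝ))) u

theorem rotateValue_dilate (R : CoordRotation) (u : L2 L) :
    rotateValue R (dilate L L' u) = dilate L L' (rotateValue R u) := by
  refine Lp.ext ?_
  have h := (measurePreserving_dilation L' L).quasiMeasurePreserving.ae_eq_comp
    (coeFn_rotateValue R u)
  filter_upwards [coeFn_dilate (L' := L') u, h, coeFn_rotateValue R (dilate L L' u),
    coeFn_dilate (L' := L') (rotateValue R u)] with x h1 h2 h3 h4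
  rw [h3, h4, h1]
  exact h2.symm

theorem translate_smul (a : Torus L) (c : ℝ) (u : L2 L) : translate a (c • u) = c • translate a u :=
  (Lp.compMeasurePreservingₗ ℝ _ (measurePreserving_sub L a)).map_smul c u

theorem rotateArgument_smul (R : CoordRotation) (c : ℝ) (u : L2 L) :
    rotateArgument R (c • u) = c • rotateArgument R u :=
  (Lp.compMeasurePreservingₗ ℝ _ (measurePreserving_torusRotation L R)).map_smul c u

theorem rotateValue_smul (R : CoordRotation) (c : ℝ) (u : L2 L) :
    rotateValue R (c • u) = c • rotateValue R u :=
  ((Matrix.toEuclideanCLM (n := Fin 3) (𝕜 := ℝ)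
    (R.1.map (Int.cast : ℤ → ℝ))).compLpₗ 2 (torusMeasure L)).map_smul c u

/-- An isometry has its inverse as adjoint. This moves test fields back to the original torus. -/
theorem inner_dilate (u : L2 L) (w : L2 L') :
    inner ℝ (dilate L L' u) w = inner ℝ u (dilate L' L w) := by
  conv_lhs => rw [← dilate_dilate (L := L') (L' := L) w, LinearIsometry.inner_map_map]

theorem integral_inner_dilation (g : Torus L → Vec) (w : L2 L') :
    ∫ x, inner ℝ (g (dilation L' L x)) (w x) ∂torusMeasure L' =
      ∫ y, inner ℝ (g y) (dilate L' L w y) ∂torusMeasure L := by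
  rw [← integral_dilation (L := L') (L' := L)]
  refine integral_congr_ae ?_
  have h := coeFn_dilate (L' := L') (dilate L' L w)
  rw [dilate_dilate] at h
  filter_upwards [h] with x hx
  rw [hx]

theorem fourierCoef_dilate (u : L2 L) (m : Fin 3 → ℤ) :
    fourierCoef (dilate L L' u) m = fourierCoef u m := by
  ext j
  simp only [fourierCoef]
  rw [← integral_dilation (L := L') (L' := L)]
  refine integral_congr_ae ?_
  filter_upwards [coeFn_dilate (L' := L') u] with x hx
  rw [hx, character_dilation]

theorem fourierCoef_smul (c : ℝ) (u : L2 L) (m : Fin 3 → ℤ) :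
    fourierCoef (c • u) m = (c : ℂ) • fourierCoef u m := by
  ext j
  simp only [fourierCoef, PiLp.smul_apply, smul_eq_mul]
  rw [← integral_const_mul]
  refine integral_congr_ae ?_
  filter_upwards [Lp.coeFn_smul c u] with x hx
  rw [hx]
  simp
  ring

end Dilation

/-! ### Rescaling of solenoidal fields -/

section Rescale

variable {L L' : ℝ} [hL : Fact (0 < L)] [hL' : Fact (0 < L')]

/-- The chain rule for a linear change of variable holds for `deriv` without any differentiability.
-/
theorem pderiv_comp_dilation (j : Fin 3) (f : Torus L → ℝ) (x : Torus L') :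
    pderiv j (fun y => f (dilation L' L y)) x = L'⁻¹ * L * pderiv j f (dilation L' L x) := by
  unfold pderiv
  simp only [map_add, dilation_single]
  have h := deriv_comp_mul_left (L'⁻¹ * L)
    (fun t : ℝ => f (dilation L' L x + Pi.single j (t : AddCircle L))) 0
  rw [mul_zero, smul_eq_mul] at h
  exact h

omit hL in
theorem pderiv_const_mul (j : Fin 3) (c : ℝ) (f : Torus L → ℝ) (x : Torus L) :
    pderiv j (fun y => c * f y) x = c * pderiv j f x :=
  deriv_const_mul_field c

theorem IsSmooth.comp_dilation {f : Torus L → ℝ} (hf : IsSmooth f) :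
    IsSmooth fun x => f (dilation L' L x) := by
  unfold IsSmooth at hf ⊢
  simp only [dilation_apply_coe]
  have h : ContDiff ℝ ((⊤ : ℕ∞) : WithTop ℕ∞) fun (y : Fin 3 → ℝ) j => L'⁻¹ * L * y j := by
    fun_prop
  exact hf.comp h

theorem IsDivFree.dilate {u : L2 L} (hu : IsDivFree u) : IsDivFree (dilate L L' u) := by
  intro φ hφ
  have h1 : ∀ x j, pderiv j φ x =
      L'⁻¹ * L * pderiv j (fun y => φ (dilation L L' y)) (dilation L' L x) := by
    intro x j
    rw [← pderiv_comp_dilation]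
    simp only [dilation_dilation]
  have h2 : ∫ x, ∑ j, NSK41.dilate L L' u x j * pderiv j φ x ∂torusMeasure L' =
      ∫ x, (fun y => L'⁻¹ * L * ∑ j, u y j * pderiv j (fun y => φ (dilation L L' y)) y)
        (dilation L' L x) ∂torusMeasure L' := by
    refine integral_congr_ae ?_
    filter_upwards [coeFn_dilate (L' := L') u] with x hx
    simp only [hx, h1, Finset.mul_sum]
    exact Finset.sum_congr rfl fun j _ => by ring
  refine h2.trans ((integral_dilation fun y : Torus L =>
    L'⁻¹ * L * ∑ j, u y j * pderiv j (fun y => φ (dilation L L' y)) y).trans ?_)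
  rw [integral_const_mul, hu _ hφ.comp_dilation, mul_zero]

theorem IsDivFree.smul {u : L2 L} (hu : IsDivFree u) (c : ℝ) : IsDivFree (c • u) := by
  intro φ hφ
  rw [← mul_zero c, ← hu φ hφ, ← integral_const_mul]
  refine integral_congr_ae ?_
  filter_upwards [Lp.coeFn_smul c u] with x hx
  simp only [hx, Pi.smul_apply, PiLp.smul_apply, smul_eq_mul, Finset.mul_sum, mul_assoc]

theorem integral_dilate (u : L2 L) :
    ∫ x, dilate L L' u x ∂torusMeasure L' = ∫ x, u x ∂torusMeasure L := by
  rw [integral_congr_ae (coeFn_dilate u), integral_dilation]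

theorem integral_smul_L2 (c : ℝ) (u : L2 L) :
    ∫ x, (c • u) x ∂torusMeasure L = c • ∫ x, u x ∂torusMeasure L := by
  rw [integral_congr_ae (Lp.coeFn_smul c u)]
  exact integral_smul c _

/-- The rescaling `u ↦ c u((L / L') ·)` of solenoidal fields. -/
def rescale (L L' : ℝ) [Fact (0 < L)] [Fact (0 < L')] (c : ℝ) (u : H L) : H L' :=
  ⟨c • dilate L L' u.1, u.2.1.dilate.smul c, by
    rw [integral_smul_L2, integral_dilate, u.2.2, smul_zero]⟩

theorem continuous_rescale (c : ℝ) : Continuous (rescale L L' c) :=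
  (((dilate L L').continuous.comp continuous_subtype_val).const_smul c).subtype_mk _

theorem rescale_rescale {c d : ℝ} (h : d * c = 1) (u : H L) :
    rescale L' L d (rescale L L' c u) = u := by
  refine Subtype.ext ?_
  change d • dilate L' L (c • dilate L L' u.1) = u.1
  rw [map_smul, dilate_dilate, smul_smul, h, one_smul]

/-- The rescaling as a homeomorphism. -/
def rescaleHomeomorph (L L' : ℝ) [Fact (0 < L)] [Fact (0 < L')] {c : ℝ} (hc : c ≠ 0) :
    H L ≃ₜ H L' where
  toFun := rescale L L' c
  invFun := rescale L' L c⁻¹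
  left_inv := rescale_rescale (inv_mul_cancel₀ hc)
  right_inv := rescale_rescale (mul_inv_cancel₀ hc)
  continuous_toFun := continuous_rescale c
  continuous_invFun := continuous_rescale c⁻¹

theorem fourierCoef_rescale (c : ℝ) (u : H L) (m : Fin 3 → ℤ) :
    fourierCoef (rescale L L' c u).1 m = (c : ℂ) • fourierCoef u.1 m := by
  change fourierCoef (c • dilate L L' u.1) m = _
  rw [fourierCoef_smul, fourierCoef_dilate]

theorem rescale_mem_galerkinSpace (c : ℝ) {n : ℕ} {u : H L} (hu : u ∈ galerkinSpace L n) :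
    rescale L L' c u ∈ galerkinSpace L' n := fun m hm => by
  rw [fourierCoef_rescale, hu m hm, smul_zero]

theorem wave_eq_smul (m : Fin 3 → ℤ) : wave L' m = (L'⁻¹ * L) • wave L m := by
  have h := hL.out.ne'
  have h' := hL'.out.ne'
  ext j
  simp only [wave, PiLp.smul_apply, smul_eq_mul]
  field_simp

/-! ### Rescaling of the Galerkin equation -/

theorem trigPoly_rescale (c : ℝ) (n : ℕ) (u : H L) (x : Torus L') :
    trigPoly n (rescale L L' c u).1 x = c • trigPoly n u.1 (dilation L' L x) := by
  ext j
  simp only [trigPoly, fourierCoef_rescale, character_dilation, PiLp.smul_apply, smul_eq_mul]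
  rw [← Complex.re_ofReal_mul, Finset.mul_sum]
  congr 1
  exact Finset.sum_congr rfl fun m _ => by ring

theorem laplace_comp_dilation (c : ℝ) (v : Torus L → Vec) (x : Torus L') :
    laplace (fun y => c • v (dilation L' L y)) x =
      (c * (L'⁻¹ * L) ^ 2) • laplace v (dilation L' L x) := by
  ext j
  simp only [laplace, PiLp.smul_apply, smul_eq_mul, Finset.mul_sum]
  refine Finset.sum_congr rfl fun i _ => ?_
  have h : pderiv i (fun z => c * v (dilation L' L z) j) =
      fun y => c * (L'⁻¹ * L * pderiv i (fun z => v z j) (dilation L' L y)) :=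
    funext fun y => (pderiv_const_mul i c _ y).trans
      (congrArg _ (pderiv_comp_dilation i (fun z => v z j) y))
  rw [h, pderiv_const_mul, pderiv_const_mul]
  rw [pderiv_comp_dilation i (pderiv i fun z => v z j)]
  ring

theorem advect_comp_dilation (c : ℝ) (v : Torus L → Vec) (x : Torus L') :
    advect (fun y => c • v (dilation L' L y)) (fun y => c • v (dilation L' L y)) x =
      (c ^ 2 * (L'⁻¹ * L)) • advect v v (dilation L' L x) := by
  ext j
  simp only [advect, PiLp.smul_apply, smul_eq_mul, pderiv_const_mul, Finset.mul_sum]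
  refine Finset.sum_congr rfl fun i _ => ?_
  rw [pderiv_comp_dilation i (fun z => v z j)]
  ring

/-- The coefficient of index m does not depend on the side of the torus, so the amplitude can be
absorbed entirely into the noise path. -/
theorem noiseField_dilation (σ : NoiseCoefficients) (n : ℕ) (c : ℝ) (b : (Fin 3 → ℤ) → Fin 3 → ℂ)
    (x : Torus L') :
    noiseField σ n (fun m j => (c : ℂ) * b m j) x = c • noiseField σ n b (dilation L' L x) := by
  ext j
  simp only [noiseField, character_dilation, PiLp.smul_apply, smul_eq_mul]
  rw [← Complex.re_ofReal_mul, Finset.mul_sum]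
  congr 1
  refine Finset.sum_congr rfl fun m _ => ?_
  have h : (fun j => (c : ℂ) * b m j) = (c : ℂ) • b m := rfl
  rw [h, Matrix.mulVec_smul, Pi.smul_apply, smul_eq_mul]
  ring

theorem integral_inner_smul_dilation (c : ℝ) (g : Torus L → Vec) (w : L2 L') :
    ∫ x, inner ℝ (c • g (dilation L' L x)) (w x) ∂torusMeasure L' =
      c * ∫ y, inner ℝ (g y) (dilate L' L w y) ∂torusMeasure L := by
  simp only [real_inner_smul_left, integral_const_mul, integral_inner_dilation]

/-- Scaling symmetry of the Galerkin equation: if `v` solves it with viscosity `ν` on the torus of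
side `L`, then `t, x ↦ l⁻¹ v(l² t, l³ x)` solves it with viscosity `ν / l⁴` and the noise path
`l⁻¹ b(l² t)` on the torus of side `L / l³`. -/
theorem IsGalerkinPath.rescale {σ : NoiseCoefficients} {ν ν' : ℝ} {n : ℕ}
    {b : (Fin 3 → ℤ) → Fin 3 → ℝ≥0 → ℂ} {v : ℝ≥0 → H L} (hv : IsGalerkinPath σ ν L n b v)
    {l : ℝ≥0} (hl : 0 < l) (hLl : L'⁻¹ * L = l ^ 3) (hν : ν' * l ^ 4 = ν) :
    IsGalerkinPath σ ν' L' n (fun m j t => ((l⁻¹ : ℝ) : ℂ) * b m j (l ^ 2 * t))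
      fun t => rescale L L' (l⁻¹ : ℝ) (v (l ^ 2 * t)) := by
  have hl0 : (l : ℝ) ≠ 0 := by exact_mod_cast hl.ne'
  refine ⟨(continuous_rescale _).comp (hv.continuous.comp (by fun_prop)),
    fun t => rescale_mem_galerkinSpace _ (hv.mem _), fun w hw t => ?_⟩
  -- The test field is only dilated (amplitude 1); the factor l⁻¹ comes from the solution.
  have hw' := rescale_mem_galerkinSpace (L' := L) 1 hw
  have key := hv.equation _ hw' (l ^ 2 * t)
  have e1 : (NSK41.rescale L' L 1 w).1 = dilate L' L w.1 := one_smul ℝ _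
  rw [e1] at key
  have e2 : ∀ u : H L, inner ℝ (NSK41.rescale L L' (l⁻¹ : ℝ) u).1 w.1 =
      (l⁻¹ : ℝ) * inner ℝ u.1 (dilate L' L w.1) := fun u => by
    change inner ℝ ((l⁻¹ : ℝ) • dilate L L' u.1) w.1 = _
    rw [real_inner_smul_left, inner_dilate]
  set F : ℝ → ℝ := fun s => ∫ x, inner ℝ
    (ν • laplace (trigPoly n (v s.toNNReal).1) x
      - advect (trigPoly n (v s.toNNReal).1) (trigPoly n (v s.toNNReal).1) x)
    (dilate L' L w.1 x) ∂torusMeasure L with hF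
  -- Both drift terms gain the same factor l: ν' l⁻¹ (l³)² = l ν for the viscous one and l⁻² l³ = l
  -- for the advective one. This fixes the exponents of the scaling.
  have e3 : ∀ s : ℝ, (∫ x, inner ℝ
      (ν' • laplace (trigPoly n (NSK41.rescale L L' (l⁻¹ : ℝ) (v (l ^ 2 * s.toNNReal))).1) x
        - advect (trigPoly n (NSK41.rescale L L' (l⁻¹ : ℝ) (v (l ^ 2 * s.toNNReal))).1)
          (trigPoly n (NSK41.rescale L L' (l⁻¹ : ℝ) (v (l ^ 2 * s.toNNReal))).1) x)
      (w.1 x) ∂torusMeasure L') = l * F (l ^ 2 * s) := by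
    intro s
    have hs : (l ^ 2 * s : ℝ).toNNReal = l ^ 2 * s.toNNReal := by
      rw [Real.toNNReal_mul (by positivity), ← NNReal.coe_pow, Real.toNNReal_coe]
    rw [hF]
    simp only [hs]
    rw [← integral_inner_smul_dilation]
    congr 1
    ext x
    congr 1
    have h := funext (trigPoly_rescale (L' := L') (l⁻¹ : ℝ) n (v (l ^ 2 * s.toNNReal)))
    rw [h, laplace_comp_dilation, advect_comp_dilation, hLl, smul_sub, smul_smul, smul_smul, ← hν]
    congr 2
    · field_simp
    · field_simp
  simp only [e3, e2, noiseField_dilation (L := L), integral_inner_smul_dilation, key]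
  -- The substitution s ↦ l² s contributes l⁻², so the drift integral has total factor l · l⁻² =
  -- l⁻¹, like the other terms.
  rw [intervalIntegral.integral_const_mul,
    intervalIntegral.integral_comp_mul_left F (pow_ne_zero 2 hl0), NNReal.coe_mul, NNReal.coe_pow,
    mul_zero, mul_zero, smul_eq_mul]
  field_simp

/-- Brownian scaling, applied to the real and imaginary parts separately; independence survives
because each path is transformed on its own by a measurable map. -/
theorem IsDrivingNoise.rescale {Ω : Type} [MeasurableSpace Ω] {P : Measure Ω}
    {β : (Fin 3 → ℤ) → Fin 3 → ℝ≥0 → Ω → ℂ} (hβ : IsDrivingNoise P β) {l : ℝ≥0} (hl : 0 < l) :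
    IsDrivingNoise P fun m j t ω => ((l⁻¹ : ℝ) : ℂ) * β m j (l ^ 2 * t) ω := by
  have hsq : √((l ^ 2 : ℝ≥0) : ℝ) = l := by
    rw [NNReal.coe_pow, Real.sqrt_sq l.coe_nonneg]
  refine ⟨fun m j t => (hβ.measurable m j _).const_mul _, fun m j t ω => ?_, fun m j => ?_,
    fun m j => ?_, ?_⟩
  · rw [hβ.conj, map_mul, Complex.conj_ofReal]
  · have h := (hβ.brownian_re m j).smul (pow_ne_zero 2 hl.ne')
    rw [hsq] at h
    convert h using 3
    rw [Complex.re_ofReal_mul]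
    ring
  · have h := (hβ.brownian_im m j).smul (pow_ne_zero 2 hl.ne')
    rw [hsq] at h
    convert h using 3
    rw [Complex.im_ofReal_mul]
    ring
  · have h := hβ.indep.comp (fun _ f t => (l⁻¹ : ℝ) * f (l ^ 2 * t))
      (fun _ => measurable_pi_lambda _ fun t => (measurable_pi_apply _).const_mul _)
    convert h using 1
    ext q ω t
    simp only [Function.comp_apply, Complex.re_ofReal_mul, Complex.im_ofReal_mul, mul_ite]

/-- The law of the rescaled field. -/
def rescaleLaw (L L' : ℝ) [Fact (0 < L)] [Fact (0 < L')] (c : ℝ) (μ : ProbabilityMeasure (H L)) :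
    ProbabilityMeasure (H L') :=
  μ.map (continuous_rescale (L := L) (L' := L') c).measurable.aemeasurable

theorem coe_rescaleLaw (c : ℝ) (μ : ProbabilityMeasure (H L)) :
    (rescaleLaw L L' c μ : Measure (H L')) = (μ : Measure (H L)).map (rescale L L' c) := rfl

theorem IsGalerkinInvariant.rescale {σ : NoiseCoefficients} {ν ν' : ℝ} {n : ℕ}
    {μ : ProbabilityMeasure (H L)} (hμ : IsGalerkinInvariant σ ν L n μ)
    {l : ℝ≥0} (hl : 0 < l) (hLl : L'⁻¹ * L = l ^ 3) (hν : ν' * l ^ 4 = ν) :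
    IsGalerkinInvariant σ ν' L' n (rescaleLaw L L' (l⁻¹ : ℝ) μ) := by
  obtain ⟨Ω, _, P, _, β, u, hβ, hu, hind, hpath, hlaw⟩ := hμ
  have hm := (continuous_rescale (L := L) (L' := L') (l⁻¹ : ℝ)).measurable
  refine ⟨Ω, _, P, ‹_›, fun m j t ω => ((l⁻¹ : ℝ) : ℂ) * β m j (l ^ 2 * t) ω,
    fun t ω => NSK41.rescale L L' (l⁻¹ : ℝ) (u (l ^ 2 * t) ω), hβ.rescale hl,
    fun t => hm.comp (hu _), ?_, ?_, fun t => ?_⟩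
  · have hψ : Measurable fun (b : (Fin 3 → ℤ) → Fin 3 → ℝ≥0 → ℂ) m j (t : ℝ≥0) =>
        ((l⁻¹ : ℝ) : ℂ) * b m j (l ^ 2 * t) := by
      fun_prop
    have h := hind.comp hm hψ
    -- Time 0 is fixed by t ↦ l² t, so the new initial datum is a function of the old one and stays
    -- independent of the noise.
    simp only [mul_zero]
    exact h
  · filter_upwards [hpath] with ω hω
    exact hω.rescale hl hLl hν
  · rw [coe_rescaleLaw, ← hlaw (l ^ 2 * t), Measure.map_map hm (hu _)]
    rfl

/-! ### Rescaling of the class `𝒫_L` and of the stationary measures -/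

theorem measurableEmbedding_rescale {c : ℝ} (hc : c ≠ 0) :
    MeasurableEmbedding (rescale L L' c) :=
  (rescaleHomeomorph L L' hc).measurableEmbedding

theorem enorm_fourierCoef_rescale (c : ℝ) (u : H L) (m : Fin 3 → ℤ) :
    ‖fourierCoef (rescale L L' c u).1 m‖ₑ = ‖c‖ₑ * ‖fourierCoef u.1 m‖ₑ := by
  rw [fourierCoef_rescale, enorm_smul]
  congr 1
  simp [enorm_eq_nnnorm]

theorem InClassP.rescale {μ : ProbabilityMeasure (H L)} (hμ : InClassP L μ) {c : ℝ} (hc : c ≠ 0) :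
    InClassP L' (rescaleLaw L L' c μ) := by
  have hemb := measurableEmbedding_rescale (L := L) (L' := L') hc
  have hsum : ∀ (p : ℕ) (u : H L),
      -- Used with p = 4 for the Stokes domain and p = 2 for the enstrophy.
      ∑' m : Fin 3 → ℤ, ‖wave L' m‖ₑ ^ p * ‖fourierCoef (NSK41.rescale L L' c u).1 m‖ₑ ^ 2 =
        ‖L'⁻¹ * L‖ₑ ^ p * ‖c‖ₑ ^ 2 *
          ∑' m : Fin 3 → ℤ, ‖wave L m‖ₑ ^ p * ‖fourierCoef u.1 m‖ₑ ^ 2 := by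
    intro p u
    rw [← ENNReal.tsum_mul_left]
    refine tsum_congr fun m => ?_
    rw [enorm_fourierCoef_rescale, wave_eq_smul (L := L), enorm_smul]
    ring
  have hfin : ∀ p : ℕ, ‖L'⁻¹ * L‖ₑ ^ p * ‖c‖ₑ ^ 2 < ∞ := fun p =>
    ENNReal.mul_lt_top (ENNReal.pow_lt_top enorm_lt_top) (ENNReal.pow_lt_top enorm_lt_top)
  have hD : Continuous fun u : L2 L => c • dilate L L' u := (dilate L L').continuous.const_smul c
  refine ⟨?_, ?_, fun a f => ?_, fun R f => ?_⟩
  · rw [coe_rescaleLaw, hemb.ae_map_iff]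
    filter_upwards [hμ.domain] with u hu
    simp only [stokesDomain, Set.mem_ofPred_eq, hsum] at hu ⊢
    exact ENNReal.mul_lt_top (hfin 4) hu
  · rw [coe_rescaleLaw, hemb.lintegral_map]
    simp only [dirichletEnergy, hsum]
    rw [lintegral_const_mul' _ _ (hfin 2).ne]
    exact ENNReal.mul_lt_top (hfin 2) hμ.finite_enstrophy
  · rw [coe_rescaleLaw, hemb.integral_map, hemb.integral_map]
    have h := hμ.homogeneous (dilation L' L a) (f.compContinuous ⟨_, hD⟩)
    simp only [BoundedContinuousFunction.compContinuous_apply, ContinuousMap.coe_mk] at h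
    rw [show (fun u : H L => f (translate a (NSK41.rescale L L' c u).1)) = fun u =>
      f (c • dilate L L' (translate (dilation L' L a) u.1)) from funext fun u => by
        rw [← translate_dilate, ← translate_smul]; rfl]
    exact h
  · rw [coe_rescaleLaw, hemb.integral_map, hemb.integral_map]
    have h := hμ.isotropic R (f.compContinuous ⟨_, hD⟩)
    simp only [BoundedContinuousFunction.compContinuous_apply, ContinuousMap.coe_mk] at h
    rw [show (fun u : H L => f (rotateArgument R (NSK41.rescale L L' c u).1)) = fun u =>
      f (c • dilate L L' (rotateArgument R u.1)) from funext fun u => by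
        rw [← rotateArgument_dilate, ← rotateArgument_smul]; rfl,
      show (fun u : H L => f (rotateValue R (NSK41.rescale L L' c u).1)) = fun u =>
      f (c • dilate L L' (rotateValue R u.1)) from funext fun u => by
        rw [← rotateValue_dilate, ← rotateValue_smul]; rfl]
    exact h

/-- Pushforward by a continuous map is weakly continuous, and the Galerkin level, being a bound on
m, is unchanged: the same sequence of levels serves for the rescaled law. -/
theorem rescaleLaw_mem_stationaryNS {σ : NoiseCoefficients} {ν ν' : ℝ}
    {μ : ProbabilityMeasure (H L)} (hμ : μ ∈ stationaryNS σ ν L)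
    {l : ℝ≥0} (hl : 0 < l) (hLl : L'⁻¹ * L = l ^ 3) (hν : ν' * l ^ 4 = ν) :
    rescaleLaw L L' (l⁻¹ : ℝ) μ ∈ stationaryNS σ ν' L' := by
  obtain ⟨k, μs, hk, hmem, hlim⟩ := hμ
  have hl0 : (l : ℝ)⁻¹ ≠ 0 := inv_ne_zero (by exact_mod_cast hl.ne')
  exact ⟨k, fun i => rescaleLaw L L' (l⁻¹ : ℝ) (μs i), hk,
    fun i => ⟨(hmem i).1.rescale hl0, (hmem i).2.rescale hl hLl hν⟩,
    ((ProbabilityMeasure.continuous_map (continuous_rescale _)).tendsto μ).comp hlim⟩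

end Rescale

/-! ### Fourier series on the torus -/

section Fourier

variable {L : ℝ} [hL : Fact (0 < L)]

theorem enorm_sq_eq_sum {𝕜 : Type*} [RCLike 𝕜] (v : EuclideanSpace 𝕜 (Fin 3)) :
    ‖v‖ₑ ^ 2 = ∑ j, ‖v j‖ₑ ^ 2 := by
  have h : ∀ {E : Type _} [NormedAddCommGroup E] (w : E), ‖w‖ₑ ^ 2 = ENNReal.ofReal (‖w‖ ^ 2) :=
    fun w => by rw [ENNReal.ofReal_pow (norm_nonneg _), ofReal_norm]
  rw [h, EuclideanSpace.norm_sq_eq, ENNReal.ofReal_sum_of_nonneg fun _ _ => by positivity]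
  refine Finset.sum_congr rfl fun j _ => ?_
  rw [ENNReal.ofReal_pow (norm_nonneg _), ofReal_norm]

theorem memLp_coord (u : L2 L) (j : Fin 3) :
    MemLp (fun x => (u x j : ℂ)) 2 (torusMeasure L) :=
  (((Lp.memLp u).continuousLinearMap_comp (EuclideanSpace.proj j : Vec →L[ℝ] ℝ))).ofReal

theorem tsum_enorm_sq_fourierCoef_unit (u : L2 1) (j : Fin 3) :
    ∑' m, ‖fourierCoef u m j‖ₑ ^ 2 = ∫⁻ x, ‖u x j‖ₑ ^ 2 ∂torusMeasure 1 := by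
  have hu := memLp_coord u j
  have hs := UnitAddTorus.hasSum_sq_mFourierCoeff (d := Fin 3) (hu.toLp _)
  have hcoef : ∀ m, ‖UnitAddTorus.mFourierCoeff (hu.toLp _) m‖ ^ 2 = ‖fourierCoef u (-m) j‖ ^ 2 := by
    intro m
    congr 2
    refine integral_congr_ae ?_
    filter_upwards [hu.coeFn_toLp] with x hx
    rw [hx]
    rfl
  have hs2 : HasSum (fun m => ‖fourierCoef u m j‖ ^ 2)
      (∫ x, ‖hu.toLp _ x‖ ^ 2 ∂torusMeasure 1) := by
    -- The convention here integrates against e^{+ik·x}, the conjugate of the usual one; the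
    -- reflection m ↦ -m corrects this.
    have h : (fun m => ‖fourierCoef u m j‖ ^ 2) =
        (fun m => ‖UnitAddTorus.mFourierCoeff (hu.toLp _) m‖ ^ 2) ∘ Equiv.neg (Fin 3 → ℤ) :=
      funext fun m => ((hcoef (-m)).trans (by rw [neg_neg])).symm
    rw [h]
    exact (Equiv.neg (Fin 3 → ℤ)).hasSum_iff.mpr hs
  calc ∑' m, ‖fourierCoef u m j‖ₑ ^ 2
      = ∑' m, ENNReal.ofReal (‖fourierCoef u m j‖ ^ 2) :=
        tsum_congr fun m => by rw [ENNReal.ofReal_pow (norm_nonneg _), ofReal_norm]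
    _ = ENNReal.ofReal (∫ x, ‖hu.toLp _ x‖ ^ 2 ∂torusMeasure 1) := by
        rw [← ENNReal.ofReal_tsum_of_nonneg (fun _ => by positivity) hs2.summable, hs2.tsum_eq]
    _ = ∫⁻ x, ENNReal.ofReal (‖hu.toLp _ x‖ ^ 2) ∂torusMeasure 1 := by
        refine ofReal_integral_eq_lintegral_ofReal ?_ (ae_of_all _ fun x => by positivity)
        exact (Lp.memLp (hu.toLp _)).integrable_norm_pow two_ne_zero
    _ = ∫⁻ x, ‖u x j‖ₑ ^ 2 ∂torusMeasure 1 := by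
        refine lintegral_congr_ae ?_
        filter_upwards [hu.coeFn_toLp] with x hx
        rw [hx, ENNReal.ofReal_pow (norm_nonneg _), Complex.norm_real, ofReal_norm]

/-- **Parseval's identity** on the torus of side `L`. -/
theorem tsum_enorm_sq_fourierCoef (u : L2 L) :
    ∑' m, ‖fourierCoef u m‖ₑ ^ 2 = ∫⁻ x, ‖u x‖ₑ ^ 2 ∂torusMeasure L := by
  have h1 : ∀ U : L2 1, ∑' m, ‖fourierCoef U m‖ₑ ^ 2 = ∫⁻ x, ‖U x‖ₑ ^ 2 ∂torusMeasure 1 := by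
    intro U
    simp only [enorm_sq_eq_sum]
    rw [Summable.tsum_finsetSum fun _ _ => ENNReal.summable, lintegral_finsetSum']
    · exact Finset.sum_congr rfl fun j _ => tsum_enorm_sq_fourierCoef_unit U j
    · intro j _
      exact (((EuclideanSpace.proj j : Vec →L[ℝ] ℝ).continuous.comp_aestronglyMeasurable
        (Lp.aestronglyMeasurable U)).enorm).pow_const 2
  -- Dilations preserve both sides, so the unit torus suffices.
  have h2 := h1 (dilate L 1 u)
  simp only [fourierCoef_dilate] at h2
  refine h2.trans ((lintegral_congr_ae
    ((coeFn_dilate (L' := 1) u).fun_comp fun v => ‖v‖ₑ ^ 2)).trans ?_)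
  exact (measurePreserving_dilation 1 L).lintegral_comp_emb measurableEmbedding_dilation
    fun y => ‖u y‖ₑ ^ 2

theorem lintegral_enorm_sq (u : L2 L) : ∫⁻ x, ‖u x‖ₑ ^ 2 ∂torusMeasure L = ‖u‖ₑ ^ 2 := by
  rw [Lp.enorm_def, eLpNorm_eq_lintegral_rpow_enorm_toReal two_ne_zero ENNReal.ofNat_ne_top,
    ← ENNReal.rpow_two, ← ENNReal.rpow_mul]
  simp

omit hL in
theorem continuous_character (m : Fin 3 → ℤ) : Continuous (character (L := L) m) :=
  continuous_finsetProd _ fun j _ => (map_continuous (fourier (m j))).comp (continuous_apply j)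

omit hL in
theorem norm_character (m : Fin 3 → ℤ) (x : Torus L) : ‖character m x‖ = 1 := by
  simp [character, fourier_apply, Circle.norm_coe]

omit hL in
theorem character_add (m : Fin 3 → ℤ) (x y : Torus L) :
    character m (x + y) = character m x * character m y := by
  simp only [character, Pi.add_apply, ← Finset.prod_mul_distrib]
  refine Finset.prod_congr rfl fun j _ => ?_
  simp [fourier_apply, AddCircle.toCircle_add]

theorem integrable_character_mul (u : L2 L) (m : Fin 3 → ℤ) (j : Fin 3) :
    Integrable (fun x => character m x * (u x j : ℂ)) (torusMeasure L) := by
  refine Integrable.bdd_mul (c := 1) ((memLp_coord u j).integrable one_le_two)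
    (continuous_character m).aestronglyMeasurable (ae_of_all _ fun x => (norm_character m x).le)

theorem fourierCoef_add (u v : L2 L) (m : Fin 3 → ℤ) :
    fourierCoef (u + v) m = fourierCoef u m + fourierCoef v m := by
  ext j
  simp only [fourierCoef, PiLp.add_apply]
  rw [← integral_add (integrable_character_mul u m j) (integrable_character_mul v m j)]
  refine integral_congr_ae ?_
  filter_upwards [Lp.coeFn_add u v] with x hx
  rw [hx]
  simp
  ring

/-- The `m`-th Fourier coefficient as a continuous linear map. -/
def fourierCoefL (L : ℝ) [Fact (0 < L)] (m : Fin 3 → ℤ) : L2 L →L[ℝ] EuclideanSpace ℂ (Fin 3) :=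
  LinearMap.mkContinuous
    { toFun := fun u => fourierCoef u m
      map_add' := fun u v => fourierCoef_add u v m
      map_smul' := fun c u => fourierCoef_smul c u m } 1 fun u => by
    have h : ‖fourierCoef u m‖ₑ ^ 2 ≤ ‖u‖ₑ ^ 2 := by
      rw [← lintegral_enorm_sq, ← tsum_enorm_sq_fourierCoef]
      exact ENNReal.le_tsum (f := fun m => ‖fourierCoef u m‖ₑ ^ 2) m
    rw [one_mul, LinearMap.coe_mk, AddHom.coe_mk]
    exact enorm_le_iff_norm_le.mp ((ENNReal.pow_le_pow_left_iff two_ne_zero).mp h)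

theorem continuous_fourierCoef (m : Fin 3 → ℤ) : Continuous fun u : L2 L => fourierCoef u m :=
  (fourierCoefL L m).continuous

theorem coeFn_translate (a : Torus L) (u : L2 L) :
    translate a u =ᵐ[torusMeasure L] fun x => u (x - a) :=
  Lp.coeFn_compMeasurePreserving u (measurePreserving_sub L a)

theorem fourierCoef_translate (a : Torus L) (u : L2 L) (m : Fin 3 → ℤ) :
    fourierCoef (translate a u) m = character m a • fourierCoef u m := by
  ext j
  simp only [fourierCoef, PiLp.smul_apply, smul_eq_mul]
  rw [← integral_const_mul]
  have h : ∫ x, character m x * (translate a u x j : ℂ) ∂torusMeasure L =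
      ∫ x, (fun y => character m a * (character m y * (u y j : ℂ))) (x - a) ∂torusMeasure L := by
    refine integral_congr_ae ?_
    filter_upwards [coeFn_translate a u] with x hx
    rw [hx]
    conv_lhs => rw [← sub_add_cancel x a, character_add]
    simp only [sub_add_cancel]
    ring
  exact h.trans (integral_sub_right_eq_self
    (fun y => character m a * (character m y * (u y j : ℂ))) a)

omit hL in
theorem norm_character_single_sub_one (m : Fin 3 → ℤ) (i : Fin 3) (t : ℝ) :
    ‖character m (Pi.single i (t : AddCircle L)) - 1‖ = |2 * Real.sin (t * wave L m i / 2)| := by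
  have h : character m (Pi.single i (t : AddCircle L)) =
      Complex.exp (Complex.I * ((t * wave L m i : ℝ) : ℂ)) := by
    rw [character, Finset.prod_eq_single i]
    · rw [Pi.single_eq_same, fourier_coe_apply, wave]
      congr 1
      push_cast
      ring
    · intro j _ hj
      simp [Pi.single_eq_of_ne hj]
    · simp
  rw [h, Complex.norm_exp_I_mul_ofReal_sub_one, Real.norm_eq_abs]

/-- Parseval for the difference of u and its translate, whose coefficients are those of u times a
character value minus 1, a factor of modulus 2|sin(t kᵢ/2)|. -/
theorem lintegral_enorm_translate_sub_sq (u : L2 L) (i : Fin 3) (t : ℝ) :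
    ∫⁻ x, ‖u (x + Pi.single i (t : AddCircle L)) - u x‖ₑ ^ 2 ∂torusMeasure L =
      ∑' m, ENNReal.ofReal (4 * Real.sin (t * wave L m i / 2) ^ 2) * ‖fourierCoef u m‖ₑ ^ 2 := by
  set a : Torus L := Pi.single i ((-t : ℝ) : AddCircle L) with ha
  have hneg : -a = Pi.single i (t : AddCircle L) := by
    rw [ha, ← Pi.single_neg, AddCircle.coe_neg, neg_neg]
  have h1 := tsum_enorm_sq_fourierCoef (translate a u + (-1 : ℝ) • u)
  have h2 : ∫⁻ x, ‖(translate a u + (-1 : ℝ) • u) x‖ₑ ^ 2 ∂torusMeasure L =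
      ∫⁻ x, ‖u (x + Pi.single i (t : AddCircle L)) - u x‖ₑ ^ 2 ∂torusMeasure L := by
    refine lintegral_congr_ae ?_
    filter_upwards [coeFn_translate a u, Lp.coeFn_add (translate a u) ((-1 : ℝ) • u),
      Lp.coeFn_smul (-1 : ℝ) u] with x hx1 hx2 hx3
    rw [hx2, Pi.add_apply, hx1, hx3, sub_eq_add_neg x a, hneg, Pi.smul_apply, neg_one_smul,
      sub_eq_add_neg]
  rw [← h2, ← h1]
  refine tsum_congr fun m => ?_
  have h3 : fourierCoef (translate a u + (-1 : ℝ) • u) m =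
      (character m a - 1) • fourierCoef u m := by
    rw [fourierCoef_add, fourierCoef_smul, fourierCoef_translate, sub_smul, one_smul]
    simp [sub_eq_add_neg]
  rw [h3, enorm_smul, mul_pow, ← ofReal_norm (character m a - 1), norm_character_single_sub_one,
    ← ENNReal.ofReal_pow (abs_nonneg _), sq_abs]
  congr 2
  rw [neg_mul, neg_div, Real.sin_neg]
  ring

end Fourier

/-! ### Point values of square-integrable fields -/

instance (L : ℝ) [Fact (0 < L)] : MeasurableSpace (L2 L) := borel (L2 L)

instance (L : ℝ) [Fact (0 < L)] : BorelSpace (L2 L) := ⟨rfl⟩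

section PointValue

variable {L : ℝ} [hL : Fact (0 < L)]

/-- The average of `u` over the cube of radius `1 / (n + 1)` around `x`. -/
def cubeAverage (n : ℕ) (x : Torus L) (u : L2 L) : Vec :=
  ⨍ y in Metric.ball x (1 / ((n : ℝ) + 1)), u y ∂torusMeasure L

/-- Each component of an average is a multiple of the L² pairing with an indicator function. -/
theorem continuous_cubeAverage (n : ℕ) (x : Torus L) : Continuous (cubeAverage n x) := by
  have h : ∀ (s : Set (Torus L)), MeasurableSet s →
      Continuous fun u : L2 L => ∫ y in s, u y ∂torusMeasure L := by
    intro s hs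
    have hb := EuclideanSpace.basisFun (Fin 3) ℝ
    have e : (fun u : L2 L => ∫ y in s, u y ∂torusMeasure L) = fun u => ∑ j,
        inner ℝ (indicatorConstLp 2 hs (measure_ne_top (torusMeasure L) s) (hb j)) u • hb j := by
      ext1 u
      simp only [L2.inner_indicatorConstLp_eq_inner_setIntegral, hb.sum_repr']
    rw [e]
    fun_prop
  unfold cubeAverage
  simp only [setAverage_eq]
  exact (h _ Metric.isOpen_ball.measurableSet).const_smul
    ((torusMeasure L).real (Metric.ball x (1 / ((n : ℝ) + 1))))⁻¹

theorem pointValue_eq_of_tendsto {u : L2 L} {x : Torus L} {a : Vec}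
    (h : Tendsto (fun n => cubeAverage n x u) atTop (𝓝 a)) : pointValue u x = a := by
  have hex : ∃ a, Tendsto (fun n => cubeAverage n x u) atTop (𝓝 a) := ⟨a, h⟩
  have e : pointValue u x = hex.choose := dif_pos hex
  rw [e]
  exact tendsto_nhds_unique hex.choose_spec h

theorem pointValue_eq_zero {u : L2 L} {x : Torus L}
    (h : ¬ ∃ a, Tendsto (fun n => cubeAverage n x u) atTop (𝓝 a)) : pointValue u x = 0 :=
  dif_neg h

theorem measurable_pointValue (x : Torus L) : Measurable fun u : L2 L => pointValue u x := by
  have hm : ∀ n, StronglyMeasurable (cubeAverage (L := L) n x) := fun n =>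
    (continuous_cubeAverage n x).measurable.stronglyMeasurable
  have hS := StronglyMeasurable.measurableSet_exists_tendsto (l := atTop) hm
  -- Cutting the averages off outside the convergence set makes them converge everywhere, to 0
  -- there, which is the default of `pointValue`.
  refine measurable_of_tendsto_metrizable
    (f := fun n => {u | ∃ a, Tendsto (fun n => cubeAverage n x u) atTop (𝓝 a)}.indicator
      (cubeAverage n x)) (fun n => (hm n).measurable.indicator hS) ?_
  rw [tendsto_pi_nhds]
  intro u
  by_cases h : ∃ a, Tendsto (fun n => cubeAverage n x u) atTop (𝓝 a)
  · obtain ⟨a, ha⟩ := h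
    rw [pointValue_eq_of_tendsto ha]
    have hu : u ∈ {u | ∃ a, Tendsto (fun n => cubeAverage n x u) atTop (𝓝 a)} := ⟨a, ha⟩
    simpa only [Set.indicator_of_mem hu] using ha
  · rw [pointValue_eq_zero h]
    have hu : u ∉ {u | ∃ a, Tendsto (fun n => cubeAverage n x u) atTop (𝓝 a)} := h
    simp only [Set.indicator_of_notMem hu, tendsto_const_nhds_iff]

theorem cubeAverage_translate (n : ℕ) (a x : Torus L) (u : L2 L) :
    cubeAverage n x (translate a u) = cubeAverage n (x - a) u := by
  have hpre : (fun y => y - a) ⁻¹' Metric.ball (x - a) (1 / ((n : ℝ) + 1)) =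
      Metric.ball x (1 / ((n : ℝ) + 1)) := by
    ext y
    simp [Metric.mem_ball]
  have hmp := measurePreserving_sub L a
  have hemb : MeasurableEmbedding fun y : Torus L => y - a := measurableEmbedding_subRight a
  unfold cubeAverage
  rw [setAverage_eq, setAverage_eq, integral_congr_ae (ae_restrict_of_ae (coeFn_translate a u))]
  have h1 := hmp.setIntegral_preimage_emb hemb (fun y => u y)
    (Metric.ball (x - a) (1 / ((n : ℝ) + 1)))
  have h2 := hmp.measure_preimage_emb hemb (Metric.ball (x - a) (1 / ((n : ℝ) + 1)))
  rw [hpre] at h1 h2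
  rw [h1, Measure.real, Measure.real, h2]

theorem pointValue_translate (a x : Torus L) (u : L2 L) :
    pointValue (translate a u) x = pointValue u (x - a) := by
  by_cases h : ∃ b, Tendsto (fun n => cubeAverage n (x - a) u) atTop (𝓝 b)
  · obtain ⟨b, hb⟩ := h
    rw [pointValue_eq_of_tendsto hb]
    refine pointValue_eq_of_tendsto ?_
    simpa only [cubeAverage_translate] using hb
  · rw [pointValue_eq_zero h]
    refine pointValue_eq_zero ?_
    simpa only [cubeAverage_translate] using h

/-! ### Lebesgue differentiation and continuity of translations -/

theorem haarAddCircle_eq_smul :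
    (AddCircle.haarAddCircle : Measure (AddCircle L)) = (ENNReal.ofReal L)⁻¹ • volume := by
  rw [AddCircle.volume_eq_smul_haarAddCircle, smul_smul, ENNReal.inv_mul_cancel, one_smul]
  · simpa using hL.out
  · exact ENNReal.ofReal_ne_top

instance : IsUnifLocDoublingMeasure (AddCircle.haarAddCircle : Measure (AddCircle L)) := by
  obtain ⟨C, hC⟩ := IsUnifLocDoublingMeasure.exists_measure_closedBall_le_mul''
    (μ := (volume : Measure (AddCircle L)))
  refine ⟨C, hC.mono fun ε hε x => ?_⟩
  rw [haarAddCircle_eq_smul, Measure.smul_apply, Measure.smul_apply, smul_eq_mul, smul_eq_mul,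
    mul_left_comm]
  exact mul_le_mul_right (hε x) _

instance : IsUnifLocDoublingMeasure (torusMeasure L) := by
  unfold torusMeasure
  infer_instance

/-- Bridges the closed balls of the differentiation theorem and the open ones of `pointValue`. -/
theorem closedBall_ae_eq_ball_torus (x : Torus L) {r : ℝ} (hr : 0 < r) :
    Metric.closedBall x r =ᵐ[torusMeasure L] Metric.ball x r := by
  rw [closedBall_pi _ hr.le, ball_pi _ hr]
  refine Measure.ae_eq_set_pi fun j _ => ?_
  rw [haarAddCircle_eq_smul]
  exact Measure.ae_smul_measure AddCircle.closedBall_ae_eq_ball _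

/-- **Lebesgue differentiation**: the point values of `u` form a representative of `u`. -/
theorem pointValue_ae_eq (u : L2 L) : pointValue u =ᵐ[torusMeasure L] u := by
  have hint : LocallyIntegrable u (torusMeasure L) :=
    ((Lp.memLp u).integrable one_le_two).locallyIntegrable
  filter_upwards [IsUnifLocDoublingMeasure.ae_tendsto_average (torusMeasure L) hint 1] with x hx
  have hpos : ∀ n : ℕ, (0 : ℝ) < 1 / ((n : ℝ) + 1) := fun n => Nat.one_div_pos_of_nat
  refine pointValue_eq_of_tendsto ?_
  have h := hx (l := atTop) (fun _ : ℕ => x) (fun n => 1 / ((n : ℝ) + 1))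
    (tendsto_nhdsWithin_iff.mpr ⟨tendsto_one_div_add_atTop_nhds_zero_nat,
      Eventually.of_forall hpos⟩)
    (Eventually.of_forall fun n => Metric.mem_closedBall_self (by simpa using (hpos n).le))
  refine h.congr fun n => ?_
  exact setAverage_congr (closedBall_ae_eq_ball_torus x (hpos n))

/-- Joint continuity supplies the measurability for Tonelli in the average over translations. -/
theorem continuous_translate :
    Continuous fun p : L2 L × Torus L => translate p.2 p.1 :=
  Continuous.compMeasurePreservingLp (f := fun p : L2 L × Torus L => p.1)
    (g := fun p : L2 L × Torus L => (⟨fun x => x - p.2, by fun_prop⟩ : C(Torus L, Torus L)))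
    continuous_fst (ContinuousMap.continuous_of_continuous_uncurry _
      (show Continuous fun q : (L2 L × Torus L) × Torus L => q.2 - q.1.2 by fun_prop))
    (fun p => measurePreserving_sub L p.2) ENNReal.ofNat_ne_top

end PointValue

/-! ### Homogeneous and isotropic laws -/

section Symmetry

variable {L : ℝ} [hL : Fact (0 < L)]

theorem continuous_rotateArgument (R : CoordRotation) :
    Continuous (rotateArgument (L := L) R) :=
  (Lp.isometry_compMeasurePreserving (measurePreserving_torusRotation L R)).continuous

theorem continuous_rotateValue (R : CoordRotation) : Continuous (rotateValue (L := L) R) :=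
  ((Matrix.toEuclideanCLM (n := Fin 3) (𝕜 := ℝ) (R.1.map (Int.cast : ℤ → ℝ))).compLpL 2
    (torusMeasure L)).continuous

/-- Bounded continuous functions determine a finite Borel measure, so a symmetry tested on them
extends to unbounded, discontinuous functionals such as those built from point values. -/
theorem lintegral_comp_eq_of_forall_integral_eq {μ : Measure (H L)} [IsProbabilityMeasure μ]
    {T S : H L → L2 L} (hT : Continuous T) (hS : Continuous S)
    (h : ∀ f : L2 L →ᵇ ℝ, ∫ u, f (T u) ∂μ = ∫ u, f (S u) ∂μ) {g : L2 L → ℝ≥0∞}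
    (hg : Measurable g) : ∫⁻ u, g (T u) ∂μ = ∫⁻ u, g (S u) ∂μ := by
  have key : μ.map T = μ.map S := by
    refine ext_of_forall_integral_eq_of_IsFiniteMeasure fun f => ?_
    rw [integral_map hT.aemeasurable f.continuous.measurable.aestronglyMeasurable,
      integral_map hS.aemeasurable f.continuous.measurable.aestronglyMeasurable, h]
  rw [← lintegral_map hg hT.measurable, key, lintegral_map hg hS.measurable]

/-- Symmetries pass to weak limits. They are imposed only on the Galerkin measures, so the limit has
to inherit them. -/
theorem integral_comp_eq_of_tendsto {μs : ℕ → ProbabilityMeasure (H L)}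
    {μ : ProbabilityMeasure (H L)} (hlim : Tendsto μs atTop (𝓝 μ)) {T S : H L → L2 L}
    (hT : Continuous T) (hS : Continuous S) (f : L2 L →ᵇ ℝ)
    (h : ∀ i, ∫ u, f (T u) ∂(μs i : Measure (H L)) = ∫ u, f (S u) ∂(μs i : Measure (H L))) :
    ∫ u, f (T u) ∂(μ : Measure (H L)) = ∫ u, f (S u) ∂(μ : Measure (H L)) := by
  rw [ProbabilityMeasure.tendsto_iff_forall_integral_tendsto] at hlim
  have h1 := hlim (f.compContinuous ⟨T, hT⟩)
  have h2 := hlim (f.compContinuous ⟨S, hS⟩)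
  simp only [BoundedContinuousFunction.compContinuous_apply, ContinuousMap.coe_mk] at h1 h2
  simp only [h] at h1
  exact tendsto_nhds_unique h1 h2

theorem continuous_translate_val (a : Torus L) : Continuous fun u : H L => translate a u.1 :=
  continuous_translate.comp (continuous_subtype_val.prodMk continuous_const)

theorem lintegral_translate_of_mem_stationaryNS {σ : NoiseCoefficients} {ν : ℝ}
    {μ : ProbabilityMeasure (H L)} (hμ : μ ∈ stationaryNS σ ν L) (a : Torus L) {g : L2 L → ℝ≥0∞}
    (hg : Measurable g) :
    ∫⁻ u, g (translate a u.1) ∂(μ : Measure (H L)) = ∫⁻ u, g u.1 ∂(μ : Measure (H L)) := by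
  obtain ⟨k, μs, -, hmem, hlim⟩ := hμ
  exact lintegral_comp_eq_of_forall_integral_eq (continuous_translate_val a) continuous_subtype_val
    (fun f => integral_comp_eq_of_tendsto hlim (continuous_translate_val a) continuous_subtype_val f
      fun i => (hmem i).1.homogeneous a f) hg

theorem lintegral_rotate_of_mem_stationaryNS {σ : NoiseCoefficients} {ν : ℝ}
    {μ : ProbabilityMeasure (H L)} (hμ : μ ∈ stationaryNS σ ν L) (R : CoordRotation)
    {g : L2 L → ℝ≥0∞} (hg : Measurable g) :
    ∫⁻ u, g (rotateArgument R u.1) ∂(μ : Measure (H L)) =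
      ∫⁻ u, g (rotateValue R u.1) ∂(μ : Measure (H L)) := by
  obtain ⟨k, μs, -, hmem, hlim⟩ := hμ
  have h1 : Continuous fun u : H L => rotateArgument R u.1 :=
    (continuous_rotateArgument R).comp continuous_subtype_val
  have h2 : Continuous fun u : H L => rotateValue R u.1 :=
    (continuous_rotateValue R).comp continuous_subtype_val
  exact lintegral_comp_eq_of_forall_integral_eq h1 h2
    (fun f => integral_comp_eq_of_tendsto hlim h1 h2 f fun i => (hmem i).1.isotropic R f) hg

theorem measurable_enorm_fourierCoef (m : Fin 3 → ℤ) :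
    Measurable fun u : L2 L => ‖fourierCoef u m‖ₑ ^ 2 :=
  ((continuous_fourierCoef m).enorm.measurable).pow_const 2

/-- For a homogeneous law, the mean square increment of the point values in a coordinate direction
is a weighted sum of the mode energies. -/
theorem lintegral_pointValue_increment {σ : NoiseCoefficients} {ν : ℝ}
    {μ : ProbabilityMeasure (H L)} (hμ : μ ∈ stationaryNS σ ν L) (i : Fin 3) (t : ℝ) :
    ∫⁻ u, ‖pointValue u.1 (Pi.single i (t : AddCircle L)) - pointValue u.1 0‖ₑ ^ 2
        ∂(μ : Measure (H L)) =
      ∑' m, ENNReal.ofReal (4 * Real.sin (t * wave L m i / 2) ^ 2) *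
        ∫⁻ u, ‖fourierCoef u.1 m‖ₑ ^ 2 ∂(μ : Measure (H L)) := by
  set e : Torus L := Pi.single i (t : AddCircle L) with he
  set g : L2 L → ℝ≥0∞ := fun u => ‖pointValue u e - pointValue u 0‖ₑ ^ 2 with hgdef
  have hg : Measurable g :=
    (((measurable_pointValue e).sub (measurable_pointValue 0)).enorm).pow_const 2
  have hjoint : Measurable fun p : H L × Torus L => g (translate p.2 p.1.1) :=
    hg.comp (continuous_translate.comp
      ((continuous_subtype_val.comp continuous_fst).prodMk continuous_snd)).measurable
  have : (torusMeasure L).IsNegInvariant := Measure.IsAddHaarMeasure.isNegInvariant_of_regular _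
  have h1 : ∀ u : L2 L, ∫⁻ a, g (translate a u) ∂torusMeasure L =
      ∑' m, ENNReal.ofReal (4 * Real.sin (t * wave L m i / 2) ^ 2) * ‖fourierCoef u m‖ₑ ^ 2 := by
    intro u
    have h2 : ∀ a, g (translate a u) = (fun x => g (translate (-x) u)) (-a) := fun a => by
      simp only [neg_neg]
    rw [lintegral_congr h2, lintegral_neg_eq_self (fun x => g (translate (-x) u)),
      ← lintegral_enorm_translate_sub_sq]
    refine lintegral_congr_ae ?_
    have h3 := (measurePreserving_add_right (torusMeasure L) e).quasiMeasurePreserving.ae_eq_comp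
      (pointValue_ae_eq u)
    filter_upwards [pointValue_ae_eq u, h3] with x hx1 hx2
    simp only [Function.comp_apply] at hx2
    simp only [hgdef, pointValue_translate, sub_neg_eq_add, zero_add, hx1, ← he, add_comm e x, hx2]
  -- Homogeneity allows averaging over all translates at no cost. After Tonelli the point values are
  -- integrated over the torus, where an almost everywhere representative is enough.
  calc ∫⁻ u, g u.1 ∂(μ : Measure (H L))
      = ∫⁻ a, ∫⁻ u, g (translate a u.1) ∂(μ : Measure (H L)) ∂torusMeasure L := by
        simp only [lintegral_translate_of_mem_stationaryNS hμ _ hg, lintegral_const, measure_univ,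
          mul_one]
    _ = ∫⁻ u, ∫⁻ a, g (translate a u.1) ∂torusMeasure L ∂(μ : Measure (H L)) :=
        lintegral_lintegral_swap (hjoint.comp measurable_swap).aemeasurable
    _ = _ := by
        have hm : ∀ m, Measurable fun u : H L => ‖fourierCoef u.1 m‖ₑ ^ 2 := fun m =>
          (measurable_enorm_fourierCoef m).comp continuous_subtype_val.measurable
        simp only [h1]
        rw [lintegral_tsum fun m => ((hm m).const_mul _).aemeasurable]
        exact tsum_congr fun m => lintegral_const_mul _ (hm m)

/-- The cyclic permutation of the coordinates. -/
def cyclicRotation : CoordRotation :=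
  ⟨!![0, 1, 0; 0, 0, 1; 1, 0, 0], by
    rw [Matrix.mem_specialOrthogonalGroup_iff, Matrix.mem_orthogonalGroup_iff]
    decide⟩

theorem cyclicRotation_apply (j l : Fin 3) :
    cyclicRotation.1 j l = if l = j + 1 then 1 else 0 := by
  fin_cases j <;> fin_cases l <;> rfl

theorem integral_comp_of_measurePreserving {α β E : Type*} [MeasurableSpace α] [MeasurableSpace β]
    [NormedAddCommGroup E] [NormedSpace ℝ E] {μ : Measure α} {ν : Measure β} {f : α → β}
    (hf : MeasurePreserving f μ ν) {g : β → E} (hg : AEStronglyMeasurable g ν) :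
    ∫ x, g (f x) ∂μ = ∫ y, g y ∂ν := by
  rw [← hf.map_eq] at hg ⊢
  exact (integral_map hf.measurable.aemeasurable hg).symm

omit hL in
theorem torusRotation_cyclic (x : Torus L) (j : Fin 3) :
    torusRotation L cyclicRotation x j = x (j + 1) := by
  simp [torusRotation, cyclicRotation_apply, ite_smul]

/-- Permuting the coordinates of m and x together leaves m · x unchanged, and the rotation preserves
the measure. -/
theorem fourierCoef_rotateArgument_cyclic (u : L2 L) (m : Fin 3 → ℤ) :
    fourierCoef (rotateArgument cyclicRotation u) m = fourierCoef u fun j => m (j + 1) := by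
  have hmp := measurePreserving_torusRotation L cyclicRotation
  have hchar : ∀ x : Torus L, character m x =
      character (fun j => m (j + 1)) (torusRotation L cyclicRotation x) := fun x => by
    simp only [character, torusRotation_cyclic]
    exact (Equiv.prod_comp (Equiv.addRight (1 : Fin 3)) fun j => fourier (m j) (x j)).symm
  ext j
  simp only [fourierCoef]
  have h : ∫ x, character m x * (rotateArgument cyclicRotation u x j : ℂ) ∂torusMeasure L =
      ∫ x, (fun y => character (fun j => m (j + 1)) y * (u y j : ℂ))
        (torusRotation L cyclicRotation x) ∂torusMeasure L := by
    refine integral_congr_ae ?_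
    filter_upwards [Lp.coeFn_compMeasurePreserving u hmp] with x hx
    rw [hchar, rotateArgument, hx, Function.comp_apply]
  exact h.trans (integral_comp_of_measurePreserving hmp
    (integrable_character_mul u _ j).aestronglyMeasurable)

theorem enorm_fourierCoef_rotateValue_cyclic (u : L2 L) (m : Fin 3 → ℤ) :
    ‖fourierCoef (rotateValue cyclicRotation u) m‖ₑ ^ 2 = ‖fourierCoef u m‖ₑ ^ 2 := by
  have h : ∀ j, fourierCoef (rotateValue cyclicRotation u) m j = fourierCoef u m (j + 1) := by
    intro j
    simp only [fourierCoef]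
    refine integral_congr_ae ?_
    filter_upwards [coeFn_rotateValue cyclicRotation u] with x hx
    rw [hx]
    congr 2
    rw [Matrix.ofLp_toEuclideanCLM]
    simp [Matrix.mulVec, dotProduct, cyclicRotation_apply]
  simp only [enorm_sq_eq_sum, h]
  exact Equiv.sum_comp (Equiv.addRight (1 : Fin 3)) fun j => ‖fourierCoef u m j‖ₑ ^ 2

theorem lintegral_fourierCoef_cyclic {σ : NoiseCoefficients} {ν : ℝ}
    {μ : ProbabilityMeasure (H L)} (hμ : μ ∈ stationaryNS σ ν L) (m : Fin 3 → ℤ) :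
    ∫⁻ u, ‖fourierCoef u.1 fun j => m (j + 1)‖ₑ ^ 2 ∂(μ : Measure (H L)) =
      ∫⁻ u, ‖fourierCoef u.1 m‖ₑ ^ 2 ∂(μ : Measure (H L)) := by
  have h := lintegral_rotate_of_mem_stationaryNS hμ cyclicRotation (measurable_enorm_fourierCoef m)
  simpa only [fourierCoef_rotateArgument_cyclic, enorm_fourierCoef_rotateValue_cyclic] using h

end Symmetry

/-! ### Elementary bounds for the increment weights -/

/-- Jordan's inequality sin y ≥ 2y/π at y = |x|/2, with π ≤ 4. -/
theorem sq_div_four_le_four_mul_sin_sq {x : ℝ} (hx : |x| ≤ Real.pi) :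
    x ^ 2 / 4 ≤ 4 * Real.sin (x / 2) ^ 2 := by
  have h1 : Real.sin (x / 2) ^ 2 = Real.sin (|x| / 2) ^ 2 := by
    rcases abs_choice x with h | h
    · rw [h]
    · rw [h, neg_div, Real.sin_neg, neg_sq]
  have h2 := Real.mul_le_sin (x := |x| / 2) (by positivity) (by linarith)
  have h3 : |x| / 4 ≤ 2 / Real.pi * (|x| / 2) := by
    rw [show 2 / Real.pi * (|x| / 2) = |x| / Real.pi by ring]
    exact div_le_div_of_nonneg_left (abs_nonneg x) Real.pi_pos Real.pi_le_four
  have h4 : (|x| / 4) ^ 2 ≤ Real.sin (|x| / 2) ^ 2 :=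
    pow_le_pow_left₀ (by positivity) (h3.trans h2) 2
  rw [div_pow, sq_abs] at h4
  rw [h1]
  linarith

theorem four_mul_sin_sq_le (x : ℝ) : 4 * Real.sin (x / 2) ^ 2 ≤ x ^ 2 := by
  have h := sq_le_sq.mpr (Real.abs_sin_le_abs (x := x / 2))
  rw [div_pow] at h
  linarith

/-- For |x| ≤ π the integrand is at least s²/12, whose integral exceeds 1/48. For |x| > π it
oscillates around 2 and the cosine integrates to at most 2/|x| ≤ 2/3, leaving at least 7/4 - 4/3. -/
theorem integral_four_mul_sin_sq_ge {x : ℝ} (hx : 1 / 3 ≤ x ^ 2) :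
    1 / 48 ≤ ∫ s in (1 / 8 : ℝ)..1, 4 * Real.sin (s * x / 2) ^ 2 := by
  have hcont : Continuous fun s : ℝ => 4 * Real.sin (s * x / 2) ^ 2 := by fun_prop
  rcases le_or_gt |x| Real.pi with h | h
  · have h1 : ∫ s in (1 / 8 : ℝ)..1, s ^ 2 / 12 ≤
        ∫ s in (1 / 8 : ℝ)..1, 4 * Real.sin (s * x / 2) ^ 2 := by
      refine intervalIntegral.integral_mono_on (by norm_num)
        (Continuous.intervalIntegrable (by fun_prop) _ _) (hcont.intervalIntegrable _ _)
        fun s hs => ?_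
      have hs0 : 0 ≤ s := by linarith [hs.1]
      have h2 : |s * x| ≤ Real.pi := by
        rw [abs_mul, abs_of_nonneg hs0]
        exact (mul_le_of_le_one_left (abs_nonneg x) hs.2).trans h
      refine le_trans ?_ (sq_div_four_le_four_mul_sin_sq h2)
      rw [mul_pow]
      nlinarith [mul_le_mul_of_nonneg_left hx (sq_nonneg s)]
    refine le_trans ?_ h1
    rw [intervalIntegral.integral_div, integral_pow]
    norm_num
  · have hx0 : x ≠ 0 := by
      rintro rfl
      norm_num at hx
    have h1 : ∀ s : ℝ, 4 * Real.sin (s * x / 2) ^ 2 = 2 - 2 * Real.cos (s * x) := fun s => by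
      have h2 := Real.cos_sq' (s * x / 2)
      have h3 := Real.cos_two_mul (s * x / 2)
      rw [mul_div_cancel₀ _ (two_ne_zero' ℝ)] at h3
      linarith
    simp only [h1]
    rw [intervalIntegral.integral_sub (by simp) (Continuous.intervalIntegrable (by fun_prop) _ _),
      intervalIntegral.integral_const, intervalIntegral.integral_const_mul,
      intervalIntegral.integral_comp_mul_right _ hx0, integral_cos]
    have h4 : |x⁻¹ * (Real.sin (1 * x) - Real.sin (1 / 8 * x))| ≤ 2 / 3 := by
      rw [abs_mul, abs_inv]
      have h5 : |Real.sin (1 * x) - Real.sin (1 / 8 * x)| ≤ 2 := by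
        rw [abs_le]
        constructor <;> linarith [Real.sin_le_one (1 * x), Real.sin_le_one (1 / 8 * x),
          Real.neg_one_le_sin (1 * x), Real.neg_one_le_sin (1 / 8 * x)]
      have h6 : |x|⁻¹ ≤ 1 / 3 := by
        rw [← one_div]
        exact one_div_le_one_div_of_le (by norm_num) (by linarith [Real.pi_gt_three])
      calc _ ≤ 1 / 3 * 2 := mul_le_mul h6 h5 (abs_nonneg _) (by norm_num)
        _ = 2 / 3 := by norm_num
    have h7 := (abs_le.mp h4).2
    simp only [smul_eq_mul]
    linarith

/-- The weight of the wave number `x` in the mean square increment over the distance `s`. -/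
def incrementWeight (s x : ℝ) : ℝ≥0∞ := ENNReal.ofReal (4 * Real.sin (s * x / 2) ^ 2)

theorem measurable_incrementWeight (x : ℝ) : Measurable fun s => incrementWeight s x := by
  unfold incrementWeight
  fun_prop

theorem incrementWeight_mul (r s x : ℝ) : incrementWeight s (r * x) = incrementWeight (r * s) x := by
  unfold incrementWeight
  rw [← mul_assoc, mul_comm s r]

theorem le_lintegral_incrementWeight {x : ℝ} (hx : 1 / 3 ≤ x ^ 2) :
    1 ≤ 48 * ∫⁻ s in Set.Ioc (1 / 8 : ℝ) 1, incrementWeight s x := by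
  have h := integral_four_mul_sin_sq_ge hx
  rw [intervalIntegral.integral_of_le (by norm_num)] at h
  have hint : IntegrableOn (fun s : ℝ => 4 * Real.sin (s * x / 2) ^ 2) (Set.Ioc (1 / 8) 1) :=
    (Continuous.integrableOn_Icc (by fun_prop)).mono_set Set.Ioc_subset_Icc_self
  have h2 : ∫⁻ s in Set.Ioc (1 / 8 : ℝ) 1, incrementWeight s x =
      ENNReal.ofReal (∫ s in Set.Ioc (1 / 8 : ℝ) 1, 4 * Real.sin (s * x / 2) ^ 2) :=
    (ofReal_integral_eq_lintegral_ofReal hint (ae_of_all _ fun s => by positivity)).symm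
  rw [h2, show (48 : ℝ≥0∞) = ENNReal.ofReal 48 by simp, ← ENNReal.ofReal_mul (by norm_num),
    ENNReal.one_le_ofReal]
  linarith

/-! ### Spectral form of the two conditions -/

/-- The mean square increment over the distance `s` in the `j`-th direction, in spectral form. -/
def spectralIncrement (τ : Triple) (j : Fin 3) (s : ℝ) : ℝ≥0∞ :=
  ∑' m, incrementWeight s (wave τ.L m j) * modeEnergy τ m

theorem meanSquareIncrement_eq {σ : NoiseCoefficients} {τ : Triple} (hτ : τ ∈ rescaledNS σ)
    (i : Fin 3) : meanSquareIncrement i τ = spectralIncrement τ i 1 :=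
  lintegral_pointValue_increment hτ i 1

/-- Reindexing the modes by the cyclic permutation moves the direction while keeping the mode
energies. -/
theorem spectralIncrement_add_one {σ : NoiseCoefficients} {τ : Triple} (hτ : τ ∈ rescaledNS σ)
    (j : Fin 3) (s : ℝ) : spectralIncrement τ (j + 1) s = spectralIncrement τ j s := by
  have h := ((Equiv.addRight (1 : Fin 3)).symm.arrowCongr (Equiv.refl ℤ)).tsum_eq
    fun m => incrementWeight s (wave τ.L m j) * modeEnergy τ m
  refine Eq.trans (tsum_congr fun m => ?_) h
  exact congrArg _ (lintegral_fourierCoef_cyclic hτ m).symm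

theorem spectralIncrement_eq {σ : NoiseCoefficients} {τ : Triple} (hτ : τ ∈ rescaledNS σ)
    (i j : Fin 3) (s : ℝ) : spectralIncrement τ j s = spectralIncrement τ i s := by
  have h0 : spectralIncrement τ 1 s = spectralIncrement τ 0 s := spectralIncrement_add_one hτ 0 s
  have h1 : spectralIncrement τ 2 s = spectralIncrement τ 1 s := spectralIncrement_add_one hτ 1 s
  fin_cases i <;> fin_cases j <;> simp [h0, h1]

/-- The triple obtained by the rescaling `u ↦ l⁻¹ u(l³ ·)`. -/
def Triple.rescale (τ : Triple) {l : ℝ≥0} (hl : 0 < l) : Triple :=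
  have : Fact (0 < τ.L / (l : ℝ) ^ 3) := ⟨div_pos τ.L_pos.out (by positivity)⟩
  { ν := τ.ν / (l : ℝ) ^ 4
    ν_pos := div_pos τ.ν_pos (by positivity)
    L := τ.L / (l : ℝ) ^ 3
    L_pos := this
    μ := rescaleLaw τ.L (τ.L / (l : ℝ) ^ 3) (l⁻¹ : ℝ) τ.μ }

theorem Triple.rescale_inv_mul (τ : Triple) {l : ℝ≥0} (hl : 0 < l) :
    (τ.rescale hl).L⁻¹ * τ.L = (l : ℝ) ^ 3 := by
  have h := τ.L_pos.out.ne'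
  have hl' : (l : ℝ) ≠ 0 := by exact_mod_cast hl.ne'
  change (τ.L / (l : ℝ) ^ 3)⁻¹ * τ.L = _
  field_simp

theorem Triple.rescale_mem {σ : NoiseCoefficients} {τ : Triple} (hτ : τ ∈ rescaledNS σ)
    {l : ℝ≥0} (hl : 0 < l) : τ.rescale hl ∈ rescaledNS σ :=
  rescaleLaw_mem_stationaryNS (L' := (τ.rescale hl).L) hτ hl (τ.rescale_inv_mul hl)
    (div_mul_cancel₀ _ (pow_ne_zero 4 (by exact_mod_cast hl.ne')))

theorem Triple.coe_rescale_μ (τ : Triple) {l : ℝ≥0} (hl : 0 < l) :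
    ((τ.rescale hl).μ : Measure (H (τ.rescale hl).L)) =
      (τ.μ : Measure (H τ.L)).map (NSK41.rescale τ.L (τ.rescale hl).L (l⁻¹ : ℝ)) := rfl

theorem modeEnergy_rescale (τ : Triple) {l : ℝ≥0} (hl : 0 < l) (m : Fin 3 → ℤ) :
    modeEnergy (τ.rescale hl) m = ‖(l⁻¹ : ℝ)‖ₑ ^ 2 * modeEnergy τ m := by
  have hl' : (l⁻¹ : ℝ) ≠ 0 := inv_ne_zero (by exact_mod_cast hl.ne')
  have h : modeEnergy (τ.rescale hl) m =
      ∫⁻ u, ‖fourierCoef (rescale τ.L (τ.rescale hl).L (l⁻¹ : ℝ) u).1 m‖ₑ ^ 2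
        ∂(τ.μ : Measure (H τ.L)) := by
    rw [modeEnergy, τ.coe_rescale_μ, (measurableEmbedding_rescale hl').lintegral_map]
  rw [h]
  simp only [enorm_fourierCoef_rescale, mul_pow]
  exact lintegral_const_mul' _ _ (ENNReal.pow_ne_top enorm_ne_top)

/-- Since the weight depends only on the product of distance and wave number, multiplying wave
numbers by l³ amounts to multiplying the distance. -/
theorem spectralIncrement_rescale (τ : Triple) {l : ℝ≥0} (hl : 0 < l) (j : Fin 3) (s : ℝ) :
    spectralIncrement (τ.rescale hl) j s =
      ‖(l⁻¹ : ℝ)‖ₑ ^ 2 * spectralIncrement τ j ((l : ℝ) ^ 3 * s) := by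
  unfold spectralIncrement
  rw [← ENNReal.tsum_mul_left]
  refine tsum_congr fun m => ?_
  rw [modeEnergy_rescale, wave_eq_smul (L := τ.L), τ.rescale_inv_mul hl, PiLp.smul_apply,
    smul_eq_mul, incrementWeight_mul]
  ring

/-! ### Mode-by-mode comparison of `lowHighSum` with the increments -/

open Classical in
/-- The contribution of one mode to `lowHighSum`. -/
def lowHighTerm (τ : Triple) (m : Fin 3 → ℤ) : ℝ≥0∞ :=
  if m = 0 then 0 else if ‖wave τ.L m‖ ≤ 1 then ‖wave τ.L m‖ₑ ^ 2 * modeEnergy τ m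
  else modeEnergy τ m

theorem lowHighSum_eq_tsum (τ : Triple) : lowHighSum τ = ∑' m, lowHighTerm τ m := by
  have h1 := tsum_subtype {m : Fin 3 → ℤ | m ≠ 0 ∧ ‖wave τ.L m‖ ≤ 1}
    fun m => ‖wave τ.L m‖ₑ ^ 2 * modeEnergy τ m
  have h2 := tsum_subtype {m : Fin 3 → ℤ | m ≠ 0 ∧ 1 < ‖wave τ.L m‖} fun m => modeEnergy τ m
  refine (congrArg₂ (· + ·) h1 h2).trans ?_
  rw [← ENNReal.tsum_add]
  refine tsum_congr fun m => ?_
  unfold lowHighTerm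
  by_cases hm : m = 0
  · simp [hm]
  · rcases le_or_gt ‖wave τ.L m‖ 1 with h | h
    · simp [hm, h, h.not_gt, Set.indicator]
    · simp [hm, h, h.not_ge, Set.indicator]

theorem enorm_wave_sq (L : ℝ) (m : Fin 3 → ℤ) :
    ‖wave L m‖ₑ ^ 2 = ∑ j, ENNReal.ofReal (wave L m j ^ 2) := by
  rw [enorm_sq_eq_sum]
  refine Finset.sum_congr rfl fun j _ => ?_
  rw [← ofReal_norm, ← ENNReal.ofReal_pow (norm_nonneg _), Real.norm_eq_abs, sq_abs]

theorem incrementWeight_mul_le_lowHighTerm (τ : Triple) (i : Fin 3) (m : Fin 3 → ℤ) :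
    incrementWeight 1 (wave τ.L m i) * modeEnergy τ m ≤ 4 * lowHighTerm τ m := by
  unfold lowHighTerm
  split_ifs with h0 h1
  · simp [h0, incrementWeight, wave]
  · rw [← mul_assoc]
    refine mul_le_mul_left ?_ _
    calc incrementWeight 1 (wave τ.L m i) ≤ ENNReal.ofReal (wave τ.L m i ^ 2) := by
          refine ENNReal.ofReal_le_ofReal ?_
          rw [one_mul]
          exact four_mul_sin_sq_le _
      _ ≤ ‖wave τ.L m‖ₑ ^ 2 := by
          rw [enorm_wave_sq]
          exact Finset.single_le_sum (f := fun j => ENNReal.ofReal (wave τ.L m j ^ 2))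
            (fun _ _ => zero_le) (Finset.mem_univ i)
      _ ≤ 4 * ‖wave τ.L m‖ₑ ^ 2 := le_mul_of_one_le_left zero_le (by norm_num)
  · refine mul_le_mul_left ?_ _
    rw [show (4 : ℝ≥0∞) = ENNReal.ofReal 4 by simp]
    refine ENNReal.ofReal_le_ofReal ?_
    linarith [Real.sin_sq_le_one (1 * wave τ.L m i / 2)]

/-- Low modes have |kⱼ| ≤ 1 ≤ π and are controlled at distance 1; a high mode has a component with
kⱼ² ≥ 1/3 and is controlled by the average over distances. The bound adds both contributions over
all j so that it has the same form for every mode and can be summed. -/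
theorem lowHighTerm_le (τ : Triple) (m : Fin 3 → ℤ) :
    lowHighTerm τ m ≤ ∑ j, (4 * (incrementWeight 1 (wave τ.L m j) * modeEnergy τ m) +
      48 * ∫⁻ s in Set.Ioc (1 / 8 : ℝ) 1,
        incrementWeight s (wave τ.L m j) * modeEnergy τ m) := by
  unfold lowHighTerm
  split_ifs with h0 h1
  · exact zero_le
  · rw [enorm_wave_sq, Finset.sum_mul]
    refine Finset.sum_le_sum fun j _ => le_add_right ?_
    rw [← mul_assoc]
    refine mul_le_mul_left ?_ _
    have hj : |wave τ.L m j| ≤ Real.pi :=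
      (PiLp.norm_apply_le (wave τ.L m) j).trans (h1.trans (by linarith [Real.pi_gt_three]))
    rw [incrementWeight, one_mul, show (4 : ℝ≥0∞) = ENNReal.ofReal 4 by simp,
      ← ENNReal.ofReal_mul (by norm_num)]
    exact ENNReal.ofReal_le_ofReal (by linarith [sq_div_four_le_four_mul_sin_sq hj])
  · obtain ⟨j, hj⟩ : ∃ j, 1 / 3 ≤ wave τ.L m j ^ 2 := by
      by_contra! hcon
      have h2 : ‖wave τ.L m‖ ^ 2 = ∑ j, wave τ.L m j ^ 2 := by
        rw [EuclideanSpace.norm_sq_eq]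
        simp
      rw [Fin.sum_univ_three] at h2
      have h3 := one_lt_pow₀ (not_le.mp h1) two_ne_zero
      linarith [hcon 0, hcon 1, hcon 2]
    refine le_trans ?_ (Finset.single_le_sum
      (f := fun j => 4 * (incrementWeight 1 (wave τ.L m j) * modeEnergy τ m) +
        48 * ∫⁻ s in Set.Ioc (1 / 8 : ℝ) 1, incrementWeight s (wave τ.L m j) * modeEnergy τ m)
      (fun _ _ => zero_le) (Finset.mem_univ j))
    refine le_add_left ?_
    rw [lintegral_mul_const _ (measurable_incrementWeight _), ← mul_assoc]
    exact le_mul_of_one_le_left zero_le (le_lintegral_incrementWeight hj)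

theorem spectralIncrement_le_lowHighSum (τ : Triple) (i : Fin 3) :
    spectralIncrement τ i 1 ≤ 4 * lowHighSum τ := by
  rw [lowHighSum_eq_tsum, ← ENNReal.tsum_mul_left]
  exact ENNReal.tsum_le_tsum fun m => incrementWeight_mul_le_lowHighTerm τ i m

theorem lowHighSum_le {τ : Triple} {C : ℝ≥0∞}
    (h : ∀ j, ∀ s ∈ Set.Icc (1 / 8 : ℝ) 1, spectralIncrement τ j s ≤ C) :
    lowHighSum τ ≤ 156 * C := by
  have hint : ∀ j, ∫⁻ s in Set.Ioc (1 / 8 : ℝ) 1, spectralIncrement τ j s ≤ C := fun j =>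
    calc ∫⁻ s in Set.Ioc (1 / 8 : ℝ) 1, spectralIncrement τ j s
        ≤ ∫⁻ _ in Set.Ioc (1 / 8 : ℝ) 1, C :=
          setLIntegral_mono measurable_const fun s hs => h j s ⟨hs.1.le, hs.2⟩
      _ = C * ENNReal.ofReal (1 - 1 / 8) := by rw [setLIntegral_const, Real.volume_Ioc]
      _ ≤ C := mul_le_of_le_one_right zero_le (by simp)
  calc lowHighSum τ
      ≤ ∑' m, ∑ j, (4 * (incrementWeight 1 (wave τ.L m j) * modeEnergy τ m) +
          48 * ∫⁻ s in Set.Ioc (1 / 8 : ℝ) 1,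
            incrementWeight s (wave τ.L m j) * modeEnergy τ m) := by
        rw [lowHighSum_eq_tsum]
        exact ENNReal.tsum_le_tsum fun m => lowHighTerm_le τ m
    _ = ∑ j, (4 * spectralIncrement τ j 1 +
          48 * ∫⁻ s in Set.Ioc (1 / 8 : ℝ) 1, spectralIncrement τ j s) := by
        rw [Summable.tsum_finsetSum fun _ _ => ENNReal.summable]
        refine Finset.sum_congr rfl fun j _ => ?_
        rw [ENNReal.tsum_add, ENNReal.tsum_mul_left, ENNReal.tsum_mul_left]
        simp only [spectralIncrement]
        rw [lintegral_tsum fun m => ((measurable_incrementWeight _).mul_const _).aemeasurable]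
    _ ≤ ∑ _j : Fin 3, (4 * C + 48 * C) :=
        Finset.sum_le_sum fun j _ => add_le_add
          (mul_le_mul_right (h j 1 ⟨by norm_num, le_rfl⟩) _) (mul_le_mul_right (hint j) _)
    -- Three directions, each contributing 4 + 48.
    _ = 156 * C := by
        rw [Finset.sum_const, Finset.card_univ, Fintype.card_fin, nsmul_eq_mul]
        ring

theorem spectralIncrement_le_of_rescale {σ : NoiseCoefficients} {τ : Triple}
    (hτ : τ ∈ rescaledNS σ) {i : Fin 3} {C : ℝ≥0∞} {s : ℝ} (hs : s ∈ Set.Icc (1 / 8 : ℝ) 1)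
    (h : ∀ (l : ℝ≥0) (hl : 0 < l), 1 / 2 ≤ (l : ℝ) → (l : ℝ) ≤ 1 →
      meanSquareIncrement i (τ.rescale hl) ≤ C) (j : Fin 3) : spectralIncrement τ j s ≤ C := by
  have hs0 : 0 ≤ s := by linarith [hs.1]
  obtain ⟨l, hl0, hls⟩ : ∃ l : ℝ, 0 ≤ l ∧ l ^ 3 = s :=
    ⟨s ^ (((3 : ℕ) : ℝ)⁻¹), by positivity, Real.rpow_inv_natCast_pow hs0 three_ne_zero⟩
  have hl2 : 1 / 2 ≤ l := by
    by_contra! hcon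
    have h1 := pow_lt_pow_left₀ hcon hl0 three_ne_zero
    norm_num at h1
    linarith [hs.1]
  have hl1 : l ≤ 1 := by
    by_contra! hcon
    have h1 := one_lt_pow₀ hcon three_ne_zero
    linarith [hs.2]
  lift l to ℝ≥0 using hl0
  have hlpos : 0 < l := by
    have h1 : (0 : ℝ) < l := by linarith
    exact_mod_cast h1
  have h1 := h l hlpos hl2 hl1
  rw [meanSquareIncrement_eq (Triple.rescale_mem hτ hlpos), spectralIncrement_rescale, mul_one,
    hls] at h1
  rw [spectralIncrement_eq hτ i j]
  -- The amplitude factor l⁻² is at least 1 because l ≤ 1, so it can be dropped.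
  refine le_trans (le_mul_of_one_le_left zero_le ?_) h1
  refine one_le_pow₀ ?_
  rw [← ofReal_norm, ENNReal.one_le_ofReal, Real.norm_eq_abs, abs_inv, abs_of_nonneg l.coe_nonneg]
  exact (one_le_inv₀ (by linarith)).mpr hl1

end

end NSK41

/-! ### Condition A implies Condition B -/

theorem mainTheorem8 (σ : NSK41.NoiseCoefficients) (i : Fin 3)
    (hA : NSK41.ConditionA i (NSK41.rescaledNS σ)) :
    NSK41.ConditionB (NSK41.rescaledNS σ) := by
  obtain ⟨D, ⟨ν₀, R₀, hν₀, hR1, hanti, hlim, rfl⟩, c, C, hc, hcC, hM⟩ := hA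
  -- The factor 16 leaves room for the viscosity ν/l⁴ ≤ 16 ν of the rescaled triples, l ≥ 1/2; the
  -- function R₀ is kept.
  have hsub : Set.Ioc 0 (ν₀ / 16) ⊆ Set.Ioc 0 ν₀ := Set.Ioc_subset_Ioc_right (by linarith)
  refine ⟨{p | 0 < p.1 ∧ p.1 < ν₀ / 16 ∧ R₀ p.1 < p.2}, ⟨ν₀ / 16, R₀, by linarith,
    fun ν hν => hR1 ν (hsub hν), hanti.mono hsub, hlim, rfl⟩, c / 4, 156 * C, by linarith,
    by linarith, fun τ hτ ⟨hν, hν16, hR⟩ => ⟨?_, ?_⟩⟩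
  · have hν' : τ.ν < ν₀ := hν16.trans (by linarith)
    have h := (hM τ hτ ⟨hν, hν', hR⟩).1
    rw [NSK41.meanSquareIncrement_eq hτ] at h
    have h4 := h.trans (NSK41.spectralIncrement_le_lowHighSum τ i)
    rw [ENNReal.ofReal_div_of_pos (by norm_num)]
    refine ENNReal.div_le_of_le_mul' ?_
    simpa using h4
  · rw [ENNReal.ofReal_mul (by norm_num), show ENNReal.ofReal 156 = 156 by simp]
    refine NSK41.lowHighSum_le fun j s hs =>
      NSK41.spectralIncrement_le_of_rescale hτ hs (i := i) (fun l hl hl2 hl1 => ?_) j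
    refine (hM _ (NSK41.Triple.rescale_mem hτ hl) ?_).2
    have hL := τ.L_pos.out
    have hl0 : (0 : ℝ) < l := by linarith
    have hp3 : (l : ℝ) ^ 3 ≤ 1 := pow_le_one₀ hl0.le hl1
    have hp4 : (l : ℝ) ^ 4 ≤ 1 := pow_le_one₀ hl0.le hl1
    have hq4 : 1 / 16 ≤ (l : ℝ) ^ 4 := by
      have h1 := pow_le_pow_left₀ (by norm_num) hl2 4
      norm_num at h1 ⊢
      exact h1
    have hν1 : τ.ν ≤ τ.ν / (l : ℝ) ^ 4 := le_div_self hν.le (by positivity) hp4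
    have hν2 : τ.ν / (l : ℝ) ^ 4 < ν₀ := by
      rw [div_lt_iff₀ (by positivity)]
      nlinarith
    have hL1 : τ.L ≤ τ.L / (l : ℝ) ^ 3 := le_div_self hL.le (by positivity) hp3
    -- Rescaling with l ≤ 1 increases both ν and L; since R₀ is decreasing, the constraint L > R₀(ν)
    -- only becomes easier.
    have hR2 : R₀ (τ.ν / (l : ℝ) ^ 4) ≤ R₀ τ.ν :=
      hanti.antitoneOn ⟨hν, by linarith⟩ ⟨by linarith, hν2.le⟩ hν1
    exact ⟨(τ.rescale hl).ν_pos, hν2, hR2.trans_lt (hR.trans_le hL1)⟩
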